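/- Let $r\ge 1$ and consider the root system of $\mathfrak{sl}_{r+1}(\mathbb{C})$ (type $A_r$) in $\mathbb{R}^{r+1}$: simple roots $\alpha_k=e_k-e_{k+1}$ ($1\le k\le r$), positive roots $\alpha_{i,j}=\alpha_i+\alpha_{i+1}+\cdots+\alpha_j$ ($1\le i\le j\le r$), highest root $\tilde\alpha=\alpha_{1,r}$, half-sum of positive roots $\rho$, and Weyl group $W$ generated by the reflections $s_k$ through the hyperplanes orthogonal to $\alpha_k$. For weights $\lambda,\mu$, the Weyl alternation set $\mathcal{A}(\lambda,\mu)$ is the set of $\sigma\in W$ such that $\wp(\sigma(\lambda+\rho)-\mu-\rho)>0$, where $\wp(\xi)$ (Kostant's partition function) is the number of ways to write $\xi$ as a linear combination of positive roots with nonnegative integer coefficients. The influence $I(\sigma)$ of $\sigma\in W$ is the set of $k$ such that $s_k$ occurs in a reduced word for $\sigma$; the extended influence $\overline{I}(\sigma)$ consists of $I(\sigma)$ and all neighbours of its elements in the Dynkin diagram. The influence of $\sigma$ is connected if $I(\sigma)$ induces a connected subgraph of the Dynkin diagram; $\sigma,\tau$ are independent if $I(\sigma)\cap\overline{I}(\tau)=\emptyset$;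 and a subset of $W$ is pairwise independent if any two distinct elements of it are independent. For $\lambda$ dominant integral and $\mathcal{A}(\lambda,\mu)$ nonempty, $\mathrm{BAS}(\lambda,\mu)$ is the unique subset $S\subseteq\mathcal{A}(\lambda,\mu)$ with $1\notin S$ such that every element of $S$ has connected influence and every element of $\mathcal{A}(\lambda,\mu)$ is the product of the elements of some (possibly empty) pairwise independent subset of $S$. **Theorem.** Let $\mu=-\alpha_{i,j}$ with $1\le i\le j\le r$ be a negative root. Then $\mathcal{A}(\tilde\alpha,\mu)$ is nonempty, the set $\mathrm{BAS}(\tilde\alpha,\mu)$ exists and is unique, and it is given explicitly as follows (a range whose lower end exceeds its upper end is empty). 1. If $i=1\le j<r$, then $\mathrm{BAS}(\tilde\alpha,\mu)$ consists of (a) $s_k$ with $1\le k<r$; (b) $s_{k+1}s_k$ with $2\le k\le j-1$; (c) $s_ks_{k+1}$ with $2\le k\le\min(j,r-2)$; (d) $s_ks_{k+1}s_k$ with $2\le k\le j-1$; (e) $s_{k+2}s_ks_{k+1}$ with $2\le k\le j-2$. 2. If $1<i\le j=r$, then $\mathrm{BAS}(\tilde\alpha,\mu)$ consists of (a) $s_k$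 with $1<k\le r$; (b) $s_{k+1}s_k$ with $\max(i-1,2)\le k\le r-2$; (c) $s_ks_{k+1}$ with $i\le k\le r-2$; (d) $s_ks_{k+1}s_k$ with $i\le k\le r-2$; (e) $s_{k+2}s_ks_{k+1}$ with $i\le k\le r-3$. 3. If $1<i\le j<r$, then $\mathrm{BAS}(\tilde\alpha,\mu)$ consists of (a) $s_k$ with $1<k<r$; (b) $s_{k+1}s_k$ with $\max(i-1,2)\le k\le j-1$; (c) $s_ks_{k+1}$ with $i\le k\le\min(j,r-2)$; (d) $s_ks_{k+1}s_k$ with $i\le k\le j-1$; (e) $s_{k+2}s_ks_{k+1}$ with $i\le k\le j-2$. 4. If $i=1$ and $j=r\ge 2$ (so $\mu=-\tilde\alpha$), then $\mathrm{BAS}(\tilde\alpha,\mu)$ consists of (a) $s_k$ with $1\le k\le r$; (b) $s_{k+1}s_k$, (c) $s_ks_{k+1}$ and (d) $s_ks_{k+1}s_k$ with $2\le k\le r-2$; (e) $s_{k+2}s_ks_{k+1}$ with $2\le k\le r-3$. If $i=j=r=1$, then $\mathrm{BAS}(\tilde\alpha,\mu)=\emptyset$. In every case, an element $\sigma\in W$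 belongs to $\mathcal{A}(\tilde\alpha,\mu)$ if and only if $\sigma$ is the product of the elements of a (possibly empty) pairwise independent subset of $\mathrm{BAS}(\tilde\alpha,\mu)$. -/

import Mathlib

/-! Weyl alternation sets and basic allowable subwords in type `A_r`, realised in `ℝ^(r+1)` with
its standard inner product. -/

namespace TypeA

/-- The ambient Euclidean space `ℝ^(r+1)` of the root system of type `A_r`. -/
abbrev Ambient (r : ℕ) : Type := EuclideanSpace ℝ (Fin (r + 1))

/-- The simple roots `e_k - e_(k+1)`. The zero-based index `k : Fin r` stands for the simple root
written `α_(k+1)` in the usual one-based numbering. -/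
noncomputable def simpleRoot (r : ℕ) (k : Fin r) : Ambient r :=
  EuclideanSpace.single k.castSucc (1 : ℝ) - EuclideanSpace.single k.succ (1 : ℝ)

/-- `α_(i,j) = α_i + α_(i+1) + ⋯ + α_j`, in one-based numbering (`1 ≤ i ≤ j ≤ r`). -/
noncomputable def rootSum (r i j : ℕ) : Ambient r :=
  ∑ k ∈ Finset.univ.filter (fun k : Fin r => i ≤ (k : ℕ) + 1 ∧ (k : ℕ) + 1 ≤ j), simpleRoot r k

/-- The highest root `α_1 + ⋯ + α_r`. -/
noncomputable def highestRoot (r : ℕ) : Ambient r := ∑ k : Fin r, simpleRoot r k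

open Classical in
/-- The positive roots `α_(i,j)` with `1 ≤ i ≤ j ≤ r`. -/
noncomputable def positiveRoots (r : ℕ) : Finset (Ambient r) :=
  ((Finset.Icc 1 r ×ˢ Finset.Icc 1 r).filter fun p => p.1 ≤ p.2).image fun p => rootSum r p.1 p.2

/-- `ρ`, half the sum of the positive roots. -/
noncomputable def rho (r : ℕ) : Ambient r := (1 / 2 : ℝ) • ∑ β ∈ positiveRoots r, β

/-- The reflection of `ℝ^(r+1)` through the hyperplane orthogonal to a simple root. -/
noncomputable def rootReflection (r : ℕ) (k : Fin r) : Ambient r ≃ₗᵢ[ℝ] Ambient r :=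
  (ℝ ∙ simpleRoot r k)ᗮ.reflection

/-- The Weyl group: the group generated by the simple reflections. Multiplication is composition
of maps, so that `(σ * τ) v = σ (τ v)`. -/
abbrev WeylGroup (r : ℕ) : Type :=
  ↥(Subgroup.closure (Set.range (rootReflection r)))

/-- The simple reflections as elements of the Weyl group (zero-based index). -/
noncomputable def simpleReflection (r : ℕ) (k : Fin r) : WeylGroup r :=
  ⟨rootReflection r k, Subgroup.subset_closure ⟨k, rfl⟩⟩

/-- The simple reflection `s_k` in one-based numbering, `1 ≤ k ≤ r` (and `1` for any other `k`). -/
noncomputable def s (r k : ℕ) : WeylGroup r :=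
  if h : 1 ≤ k ∧ k ≤ r then simpleReflection r ⟨k - 1, by omega⟩ else 1

/-- Kostant's partition function: the number of ways to write `ξ` as a linear combination of
positive roots with nonnegative integer coefficients. -/
noncomputable def kostantPartition (r : ℕ) (ξ : Ambient r) : ℕ∞ :=
  Set.encard {c : {β // β ∈ positiveRoots r} → ℕ | ∑ β, c β • (β : Ambient r) = ξ}

/-- The Weyl alternation set `A(lam, μ)`. -/
def alternationSet (r : ℕ) (lam μ : Ambient r) : Set (WeylGroup r) :=
  {σ | 0 < kostantPartition r ((σ : Ambient r ≃ₗᵢ[ℝ] Ambient r) (lam + rho r) - μ - rho r)}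

/-- A word in the simple reflections is reduced if no shorter word has the same product. -/
def IsReducedWord (r : ℕ) (w : List (Fin r)) : Prop :=
  ∀ w' : List (Fin r), (w'.map (simpleReflection r)).prod = (w.map (simpleReflection r)).prod →
    w.length ≤ w'.length

/-- The influence of `σ`: the indices of the simple reflections occurring in some reduced word
for `σ`. -/
def influence (r : ℕ) (σ : WeylGroup r) : Set (Fin r) :=
  {k | ∃ w : List (Fin r),
    IsReducedWord r w ∧ (w.map (simpleReflection r)).prod = σ ∧ k ∈ w}

/-- The Dynkin diagram: distinct indices are joined if their simple roots are not orthogonal. -/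
def dynkinDiagram (r : ℕ) : SimpleGraph (Fin r) where
  Adj k l := k ≠ l ∧ inner ℝ (simpleRoot r k) (simpleRoot r l) ≠ 0
  symm := ⟨fun _ _ h => ⟨h.1.symm, by rw [real_inner_comm]; exact h.2⟩⟩
  loopless := ⟨fun _ h => h.1 rfl⟩

/-- The extended influence: the influence together with all its neighbours. -/
def extendedInfluence (r : ℕ) (σ : WeylGroup r) : Set (Fin r) :=
  {k | k ∈ influence r σ ∨ ∃ l ∈ influence r σ, (dynkinDiagram r).Adj k l}

/-- The influence of `σ` induces a connected subgraph of the Dynkin diagram. -/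
def HasConnectedInfluence (r : ℕ) (σ : WeylGroup r) : Prop :=
  ((dynkinDiagram r).induce (influence r σ)).Connected

/-- Independence of two Weyl group elements. -/
def Independent (r : ℕ) (σ τ : WeylGroup r) : Prop :=
  influence r σ ∩ extendedInfluence r τ = ∅

/-- Pairwise independence of a set of Weyl group elements. -/
def PairwiseIndependent (r : ℕ) (T : Set (WeylGroup r)) : Prop :=
  T.Pairwise (Independent r)

/-- `σ` is the product of the elements of `T`, each taken exactly once, in some order (independent
elements commute, so for pairwise independent `T` the order does not matter). -/
def IsProductOf (r : ℕ) (T : Set (WeylGroup r)) (σ : WeylGroup r) : Prop :=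
  ∃ l : List (WeylGroup r), l.Nodup ∧ {b | b ∈ l} = T ∧ l.prod = σ

/-- The property that defines the set of basic allowable subwords of the pair `(lam, μ)`: `S` is
a subset of the alternation set without `1`, its elements have connected influence, and every
element of the alternation set is the product of a pairwise independent subset of `S`. -/
structure IsBAS (r : ℕ) (lam μ : Ambient r) (S : Set (WeylGroup r)) : Prop where
  subset : S ⊆ alternationSet r lam μ
  one_notMem : (1 : WeylGroup r) ∉ S
  connected : ∀ b ∈ S, HasConnectedInfluence r b
  generates : ∀ σ ∈ alternationSet r lam μ,
    ∃ T ⊆ S, PairwiseIndependent r T ∧ IsProductOf r T σ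

/-- The elements `s_k` with `m ≤ k ≤ n`. -/
def familyA (r m n : ℕ) : Set (WeylGroup r) :=
  {σ | ∃ k, m ≤ k ∧ k ≤ n ∧ σ = s r k}

/-- The elements `s_(k+1) s_k` with `m ≤ k ≤ n`. -/
def familyB (r m n : ℕ) : Set (WeylGroup r) :=
  {σ | ∃ k, m ≤ k ∧ k ≤ n ∧ σ = s r (k + 1) * s r k}

/-- The elements `s_k s_(k+1)` with `m ≤ k ≤ n`. -/
def familyC (r m n : ℕ) : Set (WeylGroup r) :=
  {σ | ∃ k, m ≤ k ∧ k ≤ n ∧ σ = s r k * s r (k + 1)}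

/-- The elements `s_k s_(k+1) s_k` with `m ≤ k ≤ n`. -/
def familyD (r m n : ℕ) : Set (WeylGroup r) :=
  {σ | ∃ k, m ≤ k ∧ k ≤ n ∧ σ = s r k * s r (k + 1) * s r k}

/-- The elements `s_(k+2) s_k s_(k+1)` with `m ≤ k ≤ n`. -/
def familyE (r m n : ℕ) : Set (WeylGroup r) :=
  {σ | ∃ k, m ≤ k ∧ k ≤ n ∧ σ = s r (k + 2) * s r k * s r (k + 1)}

end TypeA

namespace TypeA

/-! A Weyl group element permutes the `r + 1` coordinates. The partial sums of the coordinates of a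
vector of sum zero are its coefficients on the simple roots, so Kostant's function is positive
exactly when these are nonnegative integers. For `σ(α̃ + ρ) - μ - ρ` this reads `loss r σ m ≤ 1 + [i
≤ m + 1 ≤ j]` for all `m < r` (`mem_alternationSet_iff`).

A node `m` lies in the influence of `σ` exactly when the permutation does not preserve `{0, …, m}`
(`mem_influence_iff`), because length is the number of inversions. The loss vanishes off the
influence and is additive on independent elements. Hence the bound can be tested factor by factor,
every element splits at the gaps of its influence, and the set of basic allowable subwords is forced
to be the set of allowed elements with connected influence (`isBAS_iff`).

It remains to list these. The total displacement `shift` of a prefix is positive on the influence,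
zero off it, and at most the loss, hence at most 2. Its successive differences determine the
permutation, so an allowed connected element is a run of 1s and 2s. Injectivity leaves (1), (1,2),
(2,1), (2,2), (2,1,2), which are the five families (`exists_act_of_connected`). Loss exceeds shift
only when the influence contains an end of the diagram, and a shift of 2 at `m` requires `i ≤ m + 1
≤ j`; this gives the ranges. -/

/-! ### The Weyl group as the group of coordinate permutations. -/

theorem simpleRoot_apply (r : ℕ) (k : Fin r) (n : Fin (r + 1)) :
    simpleRoot r k n =
      (if (n : ℕ) = k then (1 : ℝ) else 0) - (if (n : ℕ) = k + 1 then 1 else 0) := by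
  simp [simpleRoot, Fin.ext_iff]

theorem inner_simpleRoot_left (r : ℕ) (k : Fin r) (v : Ambient r) :
    inner ℝ (simpleRoot r k) v = v k.castSucc - v k.succ := by
  simp [simpleRoot, inner_sub_left, EuclideanSpace.inner_single_left]

theorem rootReflection_apply (r : ℕ) (k : Fin r) (v : Ambient r) (n : Fin (r + 1)) :
    rootReflection r k v n = v (Equiv.swap k.castSucc k.succ n) := by
  have hne : k.castSucc ≠ k.succ := by simp [Fin.ext_iff]
  have hnorm : ‖simpleRoot r k‖ ^ 2 = 2 := by
    rw [← real_inner_self_eq_norm_sq, inner_simpleRoot_left, simpleRoot_apply, simpleRoot_apply]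
    simp
    norm_num
  unfold rootReflection
  rw [Submodule.reflection_orthogonal_apply, Submodule.reflection_singleton_apply,
    inner_simpleRoot_left]
  simp only [PiLp.neg_apply, PiLp.sub_apply, PiLp.smul_apply, smul_eq_mul, simpleRoot_apply]
  simp only [RCLike.ofReal_real_eq_id, id, hnorm]
  rcases eq_or_ne n k.castSucc with rfl | h1
  · rw [Equiv.swap_apply_left]; simp; ring
  · rcases eq_or_ne n k.succ with rfl | h2
    · rw [Equiv.swap_apply_right]; simp; ring
    · rw [Equiv.swap_apply_of_ne_of_ne h1 h2]
      have h1' : (n : ℕ) ≠ k := fun h => h1 (Fin.ext (by simpa using h))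
      have h2' : (n : ℕ) ≠ k + 1 := fun h => h2 (Fin.ext (by simpa using h))
      simp [h1', h2']

theorem exists_coordPerm (r : ℕ) (σ : WeylGroup r) :
    ∃ p : Equiv.Perm (Fin (r + 1)),
      ∀ v n, (σ : Ambient r ≃ₗᵢ[ℝ] Ambient r) v n = v (p n) := by
  obtain ⟨σ, hσ⟩ := σ
  induction hσ using Subgroup.closure_induction with
  | mem x hx =>
    obtain ⟨k, rfl⟩ := hx
    exact ⟨Equiv.swap k.castSucc k.succ, rootReflection_apply r k⟩
  | one => exact ⟨1, fun _ _ => rfl⟩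
  | mul x y _ _ hx hy =>
    obtain ⟨p, hp⟩ := hx
    obtain ⟨q, hq⟩ := hy
    -- Permuting indices is contravariant: `(x (y v)) n = (y v) (p n) = v (q (p n))`.
    refine ⟨q * p, fun v n => ?_⟩
    have : (x * y) v n = x (y v) n := rfl
    simp only at hp hq ⊢
    rw [this, hp, hq]; rfl
  | inv x _ hx =>
    obtain ⟨p, hp⟩ := hx
    refine ⟨p⁻¹, fun v n => ?_⟩
    simp only at hp ⊢
    have h := hp (x⁻¹ v) (p⁻¹ n)
    rw [show p (p⁻¹ n) = n from p.apply_symm_apply n] at h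
    rw [← h, show x (x⁻¹ v) = v from x.apply_symm_apply v]

/-- The permutation of the coordinates by which a Weyl group element acts. -/
noncomputable def coordPerm (r : ℕ) (σ : WeylGroup r) : Equiv.Perm (Fin (r + 1)) :=
  (exists_coordPerm r σ).choose

theorem coordPerm_spec (r : ℕ) (σ : WeylGroup r) (v : Ambient r) (n : Fin (r + 1)) :
    (σ : Ambient r ≃ₗᵢ[ℝ] Ambient r) v n = v (coordPerm r σ n) :=
  (exists_coordPerm r σ).choose_spec v n

theorem coordPerm_eq {r : ℕ} {σ : WeylGroup r} {p : Equiv.Perm (Fin (r + 1))}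
    (h : ∀ v n, (σ : Ambient r ≃ₗᵢ[ℝ] Ambient r) v n = v (p n)) : coordPerm r σ = p := by
  ext n
  have := h (EuclideanSpace.single (p n) 1) n
  rw [coordPerm_spec] at this
  simp only [PiLp.single_apply, if_true] at this
  by_contra hne
  rw [if_neg (fun h => hne (congrArg Fin.val h))] at this
  exact zero_ne_one this

/-- The coordinate permutation of a Weyl group element, as a map on `ℕ` that fixes every
`n > r`: the `n`-th coordinate of `σ v` is the coordinate of `v` with index `act r σ n`. -/
noncomputable def act (r : ℕ) (σ : WeylGroup r) (n : ℕ) : ℕ :=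
  if h : n < r + 1 then (coordPerm r σ ⟨n, h⟩ : ℕ) else n

theorem act_of_gt {r : ℕ} (σ : WeylGroup r) {n : ℕ} (h : r < n) : act r σ n = n := by
  simp [act, show ¬ n < r + 1 by omega]

theorem act_val {r : ℕ} (σ : WeylGroup r) (n : Fin (r + 1)) : act r σ n = coordPerm r σ n := by
  simp [act, n.isLt]

theorem act_le {r : ℕ} (σ : WeylGroup r) {n : ℕ} (h : n ≤ r) : act r σ n ≤ r := by
  rw [act, dif_pos (by omega)]
  exact Nat.lt_succ_iff.mp (Fin.isLt _)

theorem act_injective {r : ℕ} (σ : WeylGroup r) : Function.Injective (act r σ) := by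
  intro a b h
  rcases le_or_gt a r with ha | ha <;> rcases le_or_gt b r with hb | hb
  · rw [act, act, dif_pos (by omega), dif_pos (by omega)] at h
    simpa using (coordPerm r σ).injective (Fin.ext h)
  · have := act_le σ ha
    rw [h, act_of_gt σ hb] at this
    omega
  · have := act_le σ hb
    rw [← h, act_of_gt σ ha] at this
    omega
  · rwa [act_of_gt σ ha, act_of_gt σ hb] at h

theorem act_ext {r : ℕ} {σ τ : WeylGroup r} (h : ∀ n, act r σ n = act r τ n) : σ = τ := by
  apply Subtype.ext
  ext v n
  rw [coordPerm_spec, coordPerm_spec]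
  have e : coordPerm r σ n = coordPerm r τ n := Fin.ext (by rw [← act_val, ← act_val, h])
  rw [e]

theorem act_mul {r : ℕ} (σ τ : WeylGroup r) (n : ℕ) :
    act r (σ * τ) n = act r τ (act r σ n) := by
  have h : coordPerm r (σ * τ) = coordPerm r τ * coordPerm r σ := by
    refine coordPerm_eq fun v n => ?_
    rw [Subgroup.coe_mul]
    have : ((σ : Ambient r ≃ₗᵢ[ℝ] Ambient r) * (τ : Ambient r ≃ₗᵢ[ℝ] Ambient r)) v n =
      (σ : Ambient r ≃ₗᵢ[ℝ] Ambient r) ((τ : Ambient r ≃ₗᵢ[ℝ] Ambient r) v) n := rfl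
    rw [this, coordPerm_spec, coordPerm_spec]
    rfl
  rcases le_or_gt n r with hn | hn
  · have e : act r σ n = coordPerm r σ ⟨n, by omega⟩ := act_val σ ⟨n, by omega⟩
    rw [e, act_val, act, dif_pos (by omega), h]
    rfl
  · rw [act_of_gt _ hn, act_of_gt _ hn, act_of_gt _ hn]

theorem act_one (r n : ℕ) : act r 1 n = n := by
  have h := act_mul (1 : WeylGroup r) 1 n
  rw [mul_one] at h
  exact (act_injective _ h).symm

theorem act_simpleReflection (r : ℕ) (k : Fin r) (n : ℕ) :
    act r (simpleReflection r k) n = Equiv.swap (k : ℕ) (k + 1) n := by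
  have h : coordPerm r (simpleReflection r k) = Equiv.swap k.castSucc k.succ :=
    coordPerm_eq (rootReflection_apply r k)
  rcases le_or_gt n r with hn | hn
  · rw [act, dif_pos (by omega), h, Equiv.swap_apply_def, Equiv.swap_apply_def]
    simp only [Fin.ext_iff, Fin.val_castSucc, Fin.val_succ]
    split_ifs <;> simp_all
  · have := k.isLt
    rw [act_of_gt _ hn, Equiv.swap_apply_of_ne_of_ne] <;> omega

theorem act_s {r k : ℕ} (hk : 1 ≤ k) (hkr : k ≤ r) (n : ℕ) :
    act r (s r k) n = if n + 1 = k then n + 1 else if n = k then n - 1 else n := by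
  rw [s, dif_pos ⟨hk, hkr⟩, act_simpleReflection, Equiv.swap_apply_def]
  simp only
  split_ifs <;> omega

/-- Adjacent transpositions generate the symmetric group. This is what allows Weyl group elements to
be built by prescribing a permutation, as in `exists_cut`. -/
theorem exists_coordPerm_eq (r : ℕ) (p : Equiv.Perm (Fin (r + 1))) :
    ∃ σ : WeylGroup r, coordPerm r σ = p := by
  suffices h : ∃ σ : WeylGroup r, ∀ v n, (σ : Ambient r ≃ₗᵢ[ℝ] Ambient r) v n = v (p n) from
    h.imp fun _ => coordPerm_eq
  have hp : p ∈ Submonoid.closure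
      (Set.range fun i : Fin r => Equiv.swap i.castSucc i.succ) := by
    rw [Equiv.Perm.mclosure_swap_castSucc_succ]; trivial
  induction hp using Submonoid.closure_induction with
  | mem x hx =>
    obtain ⟨k, rfl⟩ := hx
    exact ⟨simpleReflection r k, rootReflection_apply r k⟩
  | one => exact ⟨1, fun _ _ => rfl⟩
  | mul x y _ _ hx hy =>
    obtain ⟨σ, hσ⟩ := hx
    obtain ⟨τ, hτ⟩ := hy
    refine ⟨τ * σ, fun v n => ?_⟩
    have : ((τ * σ : WeylGroup r) : Ambient r ≃ₗᵢ[ℝ] Ambient r) v n =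
      (τ : Ambient r ≃ₗᵢ[ℝ] Ambient r) ((σ : Ambient r ≃ₗᵢ[ℝ] Ambient r) v) n := rfl
    rw [this, hτ, hσ]; rfl

theorem exists_act_eq {r : ℕ} {f : ℕ → ℕ} (hf : Function.Injective f)
    (hr : ∀ n, r < n → f n = n) : ∃ σ : WeylGroup r, ∀ n, act r σ n = f n := by
  have hle : ∀ n, n < r + 1 → f n < r + 1 := by
    intro n hn
    by_contra h
    have := hf (hr (f n) (by omega))
    omega
  let g : Fin (r + 1) → Fin (r + 1) := fun n => ⟨f n, hle n n.isLt⟩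
  have hg : Function.Injective g := fun a b h => Fin.ext (hf (by simpa [g] using h))
  obtain ⟨σ, hσ⟩ := exists_coordPerm_eq r
    (Equiv.ofBijective g (Finite.injective_iff_bijective.mp hg))
  refine ⟨σ, fun n => ?_⟩
  rcases le_or_gt n r with hn | hn
  · rw [act, dif_pos (by omega), hσ]; rfl
  · rw [act_of_gt _ hn, hr n hn]

/-! ### Preserved prefixes of the coordinates. -/

/-- `σ` does not preserve the set of the coordinates with index at most `m`. -/
def Moves (r : ℕ) (σ : WeylGroup r) (m : ℕ) : Prop := ∃ a ≤ m, m < act r σ a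

theorem Moves.lt {r m : ℕ} {σ : WeylGroup r} (h : Moves r σ m) : m < r := by
  obtain ⟨a, ham, ha⟩ := h
  by_contra hm
  rcases le_or_gt a r with h | h
  · have := act_le σ h; omega
  · rw [act_of_gt σ h] at ha; omega

theorem act_le_of_not_moves {r m a : ℕ} {σ : WeylGroup r} (h : ¬ Moves r σ m) (ha : a ≤ m) :
    act r σ a ≤ m := by
  by_contra hc
  exact h ⟨a, ha, by omega⟩

/-- An injective map of a finite set into itself is onto; therefore the complement of the prefix is
preserved as well. -/
theorem image_range_of_not_moves {r m : ℕ} {σ : WeylGroup r} (h : ¬ Moves r σ m) :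
    (Finset.range (m + 1)).image (act r σ) = Finset.range (m + 1) := by
  apply Finset.eq_of_subset_of_card_le
  · intro x hx
    obtain ⟨a, ha, rfl⟩ := Finset.mem_image.mp hx
    have := act_le_of_not_moves h (Nat.lt_succ_iff.mp (Finset.mem_range.mp ha))
    exact Finset.mem_range.mpr (by omega)
  · rw [Finset.card_image_of_injective _ (act_injective σ)]

theorem lt_act_of_not_moves {r m a : ℕ} {σ : WeylGroup r} (h : ¬ Moves r σ m) (ha : m < a) :
    m < act r σ a := by
  by_contra hc
  have hmem : act r σ a ∈ (Finset.range (m + 1)).image (act r σ) := by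
    rw [image_range_of_not_moves h]; exact Finset.mem_range.mpr (by omega)
  obtain ⟨b, hb, hab⟩ := Finset.mem_image.mp hmem
  have := act_injective σ hab
  have := Finset.mem_range.mp hb
  omega

theorem moves_mul_iff_left {r m : ℕ} {σ τ : WeylGroup r} (h : ¬ Moves r τ m) :
    Moves r (σ * τ) m ↔ Moves r σ m := by
  constructor
  · rintro ⟨a, ha, hm⟩
    refine ⟨a, ha, ?_⟩
    by_contra hc
    rw [act_mul] at hm
    have := act_le_of_not_moves h (show act r σ a ≤ m by omega)
    omega
  · rintro ⟨a, ha, hm⟩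
    exact ⟨a, ha, by rw [act_mul]; exact lt_act_of_not_moves h hm⟩

theorem moves_mul_iff_right {r m : ℕ} {σ τ : WeylGroup r} (h : ¬ Moves r σ m) :
    Moves r (σ * τ) m ↔ Moves r τ m := by
  constructor
  · rintro ⟨a, ha, hm⟩
    exact ⟨act r σ a, act_le_of_not_moves h ha, by rwa [act_mul] at hm⟩
  · rintro ⟨b, hb, hm⟩
    have hmem : b ∈ (Finset.range (m + 1)).image (act r σ) := by
      rw [image_range_of_not_moves h]; exact Finset.mem_range.mpr (by omega)
    obtain ⟨a, ha, rfl⟩ := Finset.mem_image.mp hmem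
    exact ⟨a, Nat.lt_succ_iff.mp (Finset.mem_range.mp ha), by rwa [act_mul]⟩

theorem not_moves_one (r m : ℕ) : ¬ Moves r 1 m := by
  rintro ⟨a, ha, hm⟩
  rw [act_one] at hm
  omega

/-! ### Inversions, reduced words and the influence. -/

/-- The inversions of the coordinate permutation. -/
noncomputable def inversions (r : ℕ) (σ : WeylGroup r) : Finset (ℕ × ℕ) :=
  (Finset.range (r + 1) ×ˢ Finset.range (r + 1)).filter
    fun p => p.1 < p.2 ∧ act r σ p.2 < act r σ p.1

theorem mem_inversions {r : ℕ} {σ : WeylGroup r} {a b : ℕ} :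
    (a, b) ∈ inversions r σ ↔ b ≤ r ∧ a < b ∧ act r σ b < act r σ a := by
  simp only [inversions, Finset.mem_filter, Finset.mem_product, Finset.mem_range]
  omega

theorem simpleReflection_mul_self (r : ℕ) (k : Fin r) :
    simpleReflection r k * simpleReflection r k = 1 :=
  act_ext fun n => by
    rw [act_mul, act_simpleReflection, act_simpleReflection, Equiv.swap_apply_self, act_one]

theorem act_simpleReflection_mul {r : ℕ} (k : Fin r) (σ : WeylGroup r) (n : ℕ) :
    act r (simpleReflection r k * σ) n = act r σ (Equiv.swap (k : ℕ) (k + 1) n) := by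
  rw [act_mul, act_simpleReflection]

/-- Exchanging the positions `k` and `k + 1` transports the old inversions bijectively, and the only
new one is the pair `(k, k + 1)` itself. -/
theorem card_inversions_mul {r : ℕ} {k : Fin r} {σ : WeylGroup r}
    (h : act r σ k < act r σ (k + 1)) :
    (inversions r (simpleReflection r k * σ)).card = (inversions r σ).card + 1 := by
  have hk := k.isLt
  set f : ℕ × ℕ ↪ ℕ × ℕ :=
    ((Equiv.swap (k : ℕ) (k + 1)).prodCongr (Equiv.swap (k : ℕ) (k + 1))).toEmbedding with hf
  have hins : inversions r (simpleReflection r k * σ) =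
      insert ((k : ℕ), (k : ℕ) + 1) ((inversions r σ).map f) := by
    ext ⟨a, b⟩
    rw [Finset.mem_insert, mem_inversions, act_simpleReflection_mul, act_simpleReflection_mul]
    have hm : (a, b) ∈ (inversions r σ).map f ↔
        (Equiv.swap (k : ℕ) (k + 1) a, Equiv.swap (k : ℕ) (k + 1) b) ∈ inversions r σ := by
      rw [Finset.mem_map]
      constructor
      · rintro ⟨⟨x, y⟩, hxy, he⟩
        simp only [hf, Equiv.coe_toEmbedding, Equiv.prodCongr_apply, Prod.map_apply,
          Prod.mk.injEq] at he
        rwa [← he.1, ← he.2, Equiv.swap_apply_self, Equiv.swap_apply_self]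
      · intro hxy
        exact ⟨_, hxy, by simp [hf]⟩
    rw [hm, mem_inversions, Prod.mk.injEq]
    generalize (k : ℕ) = j at *
    rcases eq_or_ne a j with rfl | ha1
    · rcases eq_or_ne b (a + 1) with rfl | hb
      · simp only [Equiv.swap_apply_left, Equiv.swap_apply_right]
        exact iff_of_true (by omega) (Or.inl ⟨trivial, trivial⟩)
      · rcases eq_or_ne b a with rfl | hb'
        · simp
        · rw [Equiv.swap_apply_left, Equiv.swap_apply_of_ne_of_ne hb' hb]; omega
    · rcases eq_or_ne a (j + 1) with rfl | ha2
      · rcases eq_or_ne b j with rfl | hb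
        · simp only [Equiv.swap_apply_left, Equiv.swap_apply_right]; omega
        · rcases eq_or_ne b (j + 1) with rfl | hb'
          · simp
          · rw [Equiv.swap_apply_right, Equiv.swap_apply_of_ne_of_ne hb hb']; omega
      · rw [Equiv.swap_apply_of_ne_of_ne ha1 ha2]
        rcases eq_or_ne b j with rfl | hb
        · rw [Equiv.swap_apply_left]; omega
        · rcases eq_or_ne b (j + 1) with rfl | hb'
          · rw [Equiv.swap_apply_right]; omega
          · rw [Equiv.swap_apply_of_ne_of_ne hb hb']; omega
  rw [hins, Finset.card_insert_of_notMem, Finset.card_map]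
  intro hc
  obtain ⟨⟨x, y⟩, hxy, he⟩ := Finset.mem_map.mp hc
  simp only [hf, Equiv.coe_toEmbedding, Equiv.prodCongr_apply, Prod.map_apply,
    Prod.mk.injEq] at he
  rw [Equiv.swap_apply_eq_iff, Equiv.swap_apply_eq_iff, Equiv.swap_apply_left,
    Equiv.swap_apply_right] at he
  have := mem_inversions.mp hxy
  omega

theorem card_inversions_mul_of_gt {r : ℕ} {k : Fin r} {σ : WeylGroup r}
    (h : act r σ (k + 1) < act r σ k) :
    (inversions r σ).card = (inversions r (simpleReflection r k * σ)).card + 1 := by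
  have e : σ = simpleReflection r k * (simpleReflection r k * σ) := by
    rw [← mul_assoc, simpleReflection_mul_self, one_mul]
  conv_lhs => rw [e]
  apply card_inversions_mul
  rw [act_simpleReflection_mul, act_simpleReflection_mul, Equiv.swap_apply_left,
    Equiv.swap_apply_right]
  exact h

theorem card_inversions_prod_le (r : ℕ) (w : List (Fin r)) :
    (inversions r (w.map (simpleReflection r)).prod).card ≤ w.length := by
  induction w with
  | nil =>
    simp only [List.map_nil, List.prod_nil, List.length_nil, Nat.le_zero, Finset.card_eq_zero]
    ext ⟨a, b⟩
    simp only [mem_inversions, act_one, Finset.notMem_empty, iff_false]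
    omega
  | cons k w ih =>
    rw [List.map_cons, List.prod_cons, List.length_cons]
    set σ := (w.map (simpleReflection r)).prod
    rcases lt_trichotomy (act r σ k) (act r σ (k + 1)) with h | h | h
    · rw [card_inversions_mul h]; omega
    · have := act_injective σ h; omega
    · have := card_inversions_mul_of_gt h; omega

theorem eq_one_of_ascents {r : ℕ} {σ : WeylGroup r}
    (h : ∀ k : Fin r, act r σ k < act r σ (k + 1)) : σ = 1 := by
  have hmono : StrictMono (act r σ) := by
    apply strictMono_nat_of_lt_succ
    intro n
    rcases lt_or_ge n r with hn | hn
    · exact h ⟨n, hn⟩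
    · rw [act_of_gt σ (show r < n + 1 by omega)]
      rcases hn.eq_or_lt with rfl | hn
      · have := act_le σ (le_refl r); omega
      · rw [act_of_gt σ hn]; omega
  refine act_ext fun n => ?_
  rw [act_one]
  have h1 := hmono.le_apply (x := n)
  rcases le_or_gt n r with hn | hn
  · have h2 := hmono.add_le_nat (r + 1 - n) n
    rw [show r + 1 - n + n = r + 1 by omega, act_of_gt σ (Nat.lt_succ_self r)] at h2
    omega
  · exact act_of_gt σ hn

/-- Sorting: while some descent remains, multiplying by its reflection removes one inversion. -/
theorem exists_word_length_eq (r : ℕ) (σ : WeylGroup r) :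
    ∃ w : List (Fin r), (w.map (simpleReflection r)).prod = σ ∧
      w.length = (inversions r σ).card := by
  induction hn : (inversions r σ).card generalizing σ with
  | zero =>
    refine ⟨[], ?_, rfl⟩
    symm
    apply eq_one_of_ascents
    intro k
    rcases lt_trichotomy (act r σ k) (act r σ (k + 1)) with h | h | h
    · exact h
    · have := act_injective σ h; omega
    · have := card_inversions_mul_of_gt h; omega
  | succ n ih =>
    by_cases h : ∀ k : Fin r, act r σ k < act r σ (k + 1)
    · have := card_inversions_prod_le r []
      rw [List.map_nil, List.prod_nil, ← eq_one_of_ascents h, List.length_nil] at this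
      omega
    · push Not at h
      obtain ⟨k, hk⟩ := h
      have hlt : act r σ (k + 1) < act r σ k :=
        lt_of_le_of_ne hk fun e => by have := act_injective σ e; omega
      have := card_inversions_mul_of_gt hlt
      obtain ⟨w, hw, hl⟩ := ih (simpleReflection r k * σ) (by omega)
      refine ⟨k :: w, ?_, by simp [hl]⟩
      rw [List.map_cons, List.prod_cons, hw, ← mul_assoc, simpleReflection_mul_self, one_mul]

theorem isReducedWord_iff (r : ℕ) (w : List (Fin r)) :
    IsReducedWord r w ↔ w.length = (inversions r (w.map (simpleReflection r)).prod).card := by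
  have hle := card_inversions_prod_le r w
  constructor
  · intro h
    obtain ⟨w', hw', hl⟩ := exists_word_length_eq r (w.map (simpleReflection r)).prod
    have := h w' hw'
    omega
  · intro h w' hw'
    rw [h, ← hw']
    exact card_inversions_prod_le r w'

/-- If the product preserved `{0, …, k}`, the ascent at `k` would make `σ` map the `k + 2` indices
up to `k + 1` injectively into the `k + 1` indices up to `k`. Prefixes other than that of `k` are
preserved by the reflection. -/
theorem moves_simpleReflection_mul_iff {r : ℕ} {k : Fin r} {σ : WeylGroup r}
    (h : act r σ k < act r σ (k + 1)) (m : ℕ) :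
    Moves r (simpleReflection r k * σ) m ↔ m = k ∨ Moves r σ m := by
  rcases eq_or_ne m k with rfl | hm
  · refine iff_of_true ?_ (Or.inl rfl)
    by_contra hc
    have hle : ∀ a, a ≤ (k : ℕ) + 1 → act r σ a ≤ k := by
      intro a ha
      have h1 : act r σ (k + 1) ≤ k := by
        have := act_le_of_not_moves hc (le_refl _)
        rwa [act_simpleReflection_mul, Equiv.swap_apply_left] at this
      rcases eq_or_ne a k with rfl | ha1
      · omega
      · rcases eq_or_ne a (k + 1) with rfl | ha2
        · exact h1
        · have := act_le_of_not_moves hc (show a ≤ k by omega)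
          rwa [act_simpleReflection_mul, Equiv.swap_apply_of_ne_of_ne ha1 ha2] at this
    have hcard := Finset.card_le_card_of_injOn (s := Finset.range (k + 2))
      (t := Finset.range (k + 1)) (act r σ)
      (fun a ha => by
        have := hle a (by have := Finset.mem_range.mp ha; omega)
        exact Finset.mem_coe.mpr (Finset.mem_range.mpr (by omega)))
      (act_injective σ).injOn
    simp at hcard
  · have hs : ¬ Moves r (simpleReflection r k) m := by
      rintro ⟨a, ha, hma⟩
      rw [act_simpleReflection, Equiv.swap_apply_def] at hma
      split_ifs at hma <;> omega
    rw [moves_mul_iff_right hs]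
    exact ⟨Or.inr, fun h => h.resolve_left hm⟩

/-- Counting inversions shows that each letter of a reduced word is prepended at an ascent, so it
adds exactly its own node. In particular all reduced words of an element have the same letters. -/
theorem mem_word_iff_moves {r : ℕ} {w : List (Fin r)}
    (hw : w.length = (inversions r (w.map (simpleReflection r)).prod).card) (k : Fin r) :
    k ∈ w ↔ Moves r (w.map (simpleReflection r)).prod k := by
  induction w with
  | nil => simpa using not_moves_one r k
  | cons i w ih =>
    rw [List.map_cons, List.prod_cons, List.length_cons] at hw
    rw [List.map_cons, List.prod_cons, List.mem_cons]
    have hle := card_inversions_prod_le r w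
    set σ := (w.map (simpleReflection r)).prod with hσ
    rcases lt_trichotomy (act r σ i) (act r σ (i + 1)) with h | h | h
    · rw [card_inversions_mul h] at hw
      rw [moves_simpleReflection_mul_iff h, ih (by omega), Fin.ext_iff]
    · have := act_injective σ h; omega
    · have := card_inversions_mul_of_gt h; omega

theorem mem_influence_iff {r : ℕ} {σ : WeylGroup r} {k : Fin r} :
    k ∈ influence r σ ↔ Moves r σ k := by
  constructor
  · rintro ⟨w, hw, rfl, hk⟩
    exact (mem_word_iff_moves ((isReducedWord_iff r w).mp hw) k).mp hk
  · intro h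
    obtain ⟨w, rfl, hl⟩ := exists_word_length_eq r σ
    exact ⟨w, (isReducedWord_iff r w).mpr hl, rfl, (mem_word_iff_moves hl k).mpr h⟩

/-! ### Coordinates of the roots and positivity of the partition function. -/

/-- The coordinates of a vector, extended by zero to all natural indices. -/
noncomputable def coord (r : ℕ) (v : Ambient r) (n : ℕ) : ℝ :=
  if h : n < r + 1 then v ⟨n, h⟩ else 0

theorem coord_val {r : ℕ} (v : Ambient r) (n : Fin (r + 1)) : coord r v n = v n := by
  simp [coord, n.isLt]

theorem coord_add {r : ℕ} (v w : Ambient r) (n : ℕ) :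
    coord r (v + w) n = coord r v n + coord r w n := by
  unfold coord; split_ifs <;> simp

theorem coord_sub {r : ℕ} (v w : Ambient r) (n : ℕ) :
    coord r (v - w) n = coord r v n - coord r w n := by
  unfold coord; split_ifs <;> simp

theorem coord_neg {r : ℕ} (v : Ambient r) (n : ℕ) : coord r (-v) n = -coord r v n := by
  unfold coord; split_ifs <;> simp

theorem coord_smul {r : ℕ} (c : ℝ) (v : Ambient r) (n : ℕ) :
    coord r (c • v) n = c * coord r v n := by
  unfold coord; split_ifs <;> simp

theorem coord_nsmul {r : ℕ} (c : ℕ) (v : Ambient r) (n : ℕ) :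
    coord r (c • v) n = c * coord r v n := by
  unfold coord; split_ifs <;> simp

theorem coord_zero (r n : ℕ) : coord r 0 n = 0 := by
  unfold coord; split_ifs <;> simp

theorem coord_sum {r : ℕ} {ι : Type*} (t : Finset ι) (f : ι → Ambient r) (n : ℕ) :
    coord r (∑ x ∈ t, f x) n = ∑ x ∈ t, coord r (f x) n := by
  classical
  induction t using Finset.induction_on with
  | empty => simp [coord_zero]
  | insert a t ha ih => rw [Finset.sum_insert ha, Finset.sum_insert ha, coord_add, ih]

theorem coord_ext {r : ℕ} {v w : Ambient r} (h : ∀ n, n ≤ r → coord r v n = coord r w n) :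
    v = w := by
  ext n
  rw [← coord_val, ← coord_val, h n (by omega)]

theorem coord_weyl {r : ℕ} (σ : WeylGroup r) (v : Ambient r) (n : ℕ) :
    coord r ((σ : Ambient r ≃ₗᵢ[ℝ] Ambient r) v) n = coord r v (act r σ n) := by
  rcases le_or_gt n r with hn | hn
  · have e : act r σ n = coordPerm r σ ⟨n, by omega⟩ := act_val σ ⟨n, by omega⟩
    rw [e, coord_val, coord, dif_pos (by omega), coordPerm_spec]
  · rw [act_of_gt σ hn, coord, coord, dif_neg (by omega), dif_neg (by omega)]

theorem coord_simpleRoot {r : ℕ} (k : Fin r) (n : ℕ) :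
    coord r (simpleRoot r k) n = (if n = k then (1 : ℝ) else 0) - (if n = k + 1 then 1 else 0) := by
  have := k.isLt
  rcases le_or_gt n r with hn | hn
  · rw [coord, dif_pos (by omega), simpleRoot_apply]
  · rw [coord, dif_neg (by omega), if_neg (by omega), if_neg (by omega), sub_zero]

theorem rootSum_succ {r i j : ℕ} (hij : i ≤ j + 1) (hj : j < r) :
    rootSum r i (j + 1) = rootSum r i j + simpleRoot r ⟨j, hj⟩ := by
  have e : Finset.univ.filter (fun k : Fin r => i ≤ (k : ℕ) + 1 ∧ (k : ℕ) + 1 ≤ j + 1) =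
      insert ⟨j, hj⟩ (Finset.univ.filter fun k : Fin r => i ≤ (k : ℕ) + 1 ∧ (k : ℕ) + 1 ≤ j) := by
    ext k
    simp only [Finset.mem_filter, Finset.mem_univ, true_and, Finset.mem_insert, Fin.ext_iff]
    omega
  rw [rootSum, e, Finset.sum_insert (by simp), add_comm]
  rfl

/-- The sum telescopes to `e_(i-1) - e_j` in zero-based coordinates. The empty sum `i = j + 1` is
admitted so that the induction on `j` can start. -/
theorem coord_rootSum {r i j : ℕ} (hi : 1 ≤ i) (hij : i ≤ j + 1) (hj : j ≤ r) (n : ℕ) :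
    coord r (rootSum r i j) n =
      (if n + 1 = i then (1 : ℝ) else 0) - (if n = j then 1 else 0) := by
  induction j with
  | zero =>
    have e : rootSum r i 0 = 0 := by
      unfold rootSum
      apply Finset.sum_eq_zero
      intro k hk
      have := (Finset.mem_filter.mp hk).2
      omega
    rw [e, coord_zero]
    split_ifs <;> first | omega | norm_num
  | succ j ih =>
    rcases eq_or_ne i (j + 2) with rfl | hne
    · have e : rootSum r (j + 2) (j + 1) = 0 := by
        unfold rootSum
        apply Finset.sum_eq_zero
        intro k hk
        have := (Finset.mem_filter.mp hk).2
        omega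
      rw [e, coord_zero]
      split_ifs <;> first | omega | norm_num
    · rw [rootSum_succ (by omega) (by omega), coord_add, ih (by omega) (by omega),
        coord_simpleRoot]
      simp only
      ring

theorem highestRoot_eq_rootSum (r : ℕ) : highestRoot r = rootSum r 1 r := by
  unfold highestRoot rootSum
  rw [Finset.filter_true_of_mem]
  intro k _
  omega

/-- Makes the sum over the finset of roots in `rho` a sum over index pairs without repetition. -/
theorem rootSum_injOn (r : ℕ) :
    Set.InjOn (fun p : ℕ × ℕ => rootSum r p.1 p.2)
      ((Finset.Icc 1 r ×ˢ Finset.Icc 1 r).filter fun p => p.1 ≤ p.2 : Finset (ℕ × ℕ)) := by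
  rintro ⟨a, b⟩ hab ⟨c, d⟩ hcd h
  simp only [Finset.coe_filter, Finset.mem_product, Finset.mem_Icc, Set.mem_ofPred_eq] at hab hcd h
  have key : ∀ n, (if n + 1 = a then (1 : ℝ) else 0) - (if n = b then 1 else 0) =
      (if n + 1 = c then (1 : ℝ) else 0) - (if n = d then 1 else 0) := by
    intro n
    rw [← coord_rootSum (r := r), ← coord_rootSum (r := r), h] <;> omega
  have h1 := key (a - 1)
  have h2 := key b
  have hac : a = c := by
    by_contra hne
    rw [if_pos (by omega), if_neg (by omega), if_neg (by omega)] at h1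
    split_ifs at h1 <;> norm_num at h1
  have hbd : b = d := by
    by_contra hne
    rw [if_neg (by omega), if_pos rfl, if_neg (show b ≠ d from hne)] at h2
    split_ifs at h2 <;> norm_num at h2
  rw [hac, hbd]

theorem coord_rho {r n : ℕ} (hn : n ≤ r) : coord r (rho r) n = (r : ℝ) / 2 - n := by
  classical
  have hsum : ∑ β ∈ positiveRoots r, β =
      ∑ p ∈ (Finset.Icc 1 r ×ˢ Finset.Icc 1 r).filter (fun p => p.1 ≤ p.2),
        rootSum r p.1 p.2 := by
    unfold positiveRoots
    rw [Finset.sum_image (rootSum_injOn r)]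
  -- Coordinate `n` receives `+1` from the `r - n` roots starting at `n + 1` and `-1` from the `n`
  -- roots ending at `n`.
  have h1 : ((Finset.Icc 1 r ×ˢ Finset.Icc 1 r).filter
      (fun p => p.1 ≤ p.2 ∧ n + 1 = p.1)).card = r - n := by
    rw [show (Finset.Icc 1 r ×ˢ Finset.Icc 1 r).filter (fun p => p.1 ≤ p.2 ∧ n + 1 = p.1) =
      {n + 1} ×ˢ Finset.Icc (n + 1) r by
        ext ⟨a, b⟩
        simp only [Finset.mem_filter, Finset.mem_product, Finset.mem_Icc, Finset.mem_singleton]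
        omega]
    simp
  have h2 : ((Finset.Icc 1 r ×ˢ Finset.Icc 1 r).filter
      (fun p => p.1 ≤ p.2 ∧ n = p.2)).card = n := by
    rw [show (Finset.Icc 1 r ×ˢ Finset.Icc 1 r).filter (fun p => p.1 ≤ p.2 ∧ n = p.2) =
      Finset.Icc 1 n ×ˢ {n} by
        ext ⟨a, b⟩
        simp only [Finset.mem_filter, Finset.mem_product, Finset.mem_Icc, Finset.mem_singleton]
        omega]
    simp
  rw [rho, coord_smul, hsum, coord_sum]
  rw [Finset.sum_congr rfl (g := fun p : ℕ × ℕ =>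
      (if n + 1 = p.1 then (1 : ℝ) else 0) - (if n = p.2 then 1 else 0))]
  · rw [Finset.sum_sub_distrib, Finset.sum_boole, Finset.sum_boole, Finset.filter_filter,
      Finset.filter_filter, h1, h2, Nat.cast_sub hn]
    ring
  · intro p hp
    simp only [Finset.mem_filter, Finset.mem_product, Finset.mem_Icc] at hp
    exact coord_rootSum (by omega) (by omega) (by omega) n

/-- Each positive root `e_(i-1) - e_j` has nonnegative partial sums, so nonnegativity is necessary.
It is sufficient because the simple roots alone then represent `ξ`, with the partial sums as
coefficients. -/
theorem kostantPartition_pos_iff {r : ℕ} {ξ : Ambient r} {z : ℕ → ℤ}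
    (hz : ∀ m, m ≤ r → ∑ n ∈ Finset.range (m + 1), coord r ξ n = z m) (hr : z r = 0) :
    0 < kostantPartition r ξ ↔ ∀ m, m < r → 0 ≤ z m := by
  classical
  rw [kostantPartition, Set.encard_pos]
  constructor
  · rintro ⟨c, rfl⟩ m hm
    have h : (0 : ℝ) ≤ z m := by
      rw [← hz m hm.le]
      simp only [coord_sum]
      rw [Finset.sum_comm]
      apply Finset.sum_nonneg
      rintro ⟨β, hβ⟩ _
      simp only [coord_nsmul]
      rw [← Finset.mul_sum]
      apply mul_nonneg (Nat.cast_nonneg _)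
      obtain ⟨⟨i, j⟩, hij, rfl⟩ := Finset.mem_image.mp hβ
      simp only [Finset.mem_filter, Finset.mem_product, Finset.mem_Icc] at hij
      rw [Finset.sum_congr rfl fun n _ =>
        coord_rootSum (r := r) (i := i) (j := j) (by omega) (by omega) (by omega) n,
        Finset.sum_sub_distrib, sub_nonneg, Finset.sum_ite_eq' (Finset.range (m + 1)) j]
      split_ifs with hj
      · have : i - 1 ∈ Finset.range (m + 1) := by
          rw [Finset.mem_range] at *; omega
        refine le_trans ?_ (Finset.single_le_sum (fun n _ => ?_) this)
        · rw [if_pos (by omega)]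
        · split_ifs <;> norm_num
      · exact Finset.sum_nonneg fun n _ => by split_ifs <;> norm_num
    exact_mod_cast h
  · intro hnn
    have hmem : ∀ k : Fin r, simpleRoot r k ∈ positiveRoots r := by
      intro k
      have hk := k.isLt
      refine Finset.mem_image.mpr ⟨((k : ℕ) + 1, (k : ℕ) + 1), ?_, ?_⟩
      · simp only [Finset.mem_filter, Finset.mem_product, Finset.mem_Icc]
        omega
      · refine coord_ext fun n _ => ?_
        rw [coord_rootSum (by omega) (by omega) (by omega), coord_simpleRoot]
        simp
    refine ⟨fun β => ∑ k : Fin r, if (⟨simpleRoot r k, hmem k⟩ : {β // β ∈ positiveRoots r}) = β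
      then (z k).toNat else 0, ?_⟩
    rw [Set.mem_ofPred_eq]
    have e : (∑ β : {β // β ∈ positiveRoots r}, (∑ k : Fin r,
        if (⟨simpleRoot r k, hmem k⟩ : {β // β ∈ positiveRoots r}) = β
          then (z k).toNat else 0) • (β : Ambient r)) =
        ∑ k : Fin r, (z k).toNat • simpleRoot r k := by
      simp only [Finset.sum_smul]
      rw [Finset.sum_comm]
      refine Finset.sum_congr rfl fun k _ => ?_
      simp only [ite_smul, zero_smul, Finset.sum_ite_eq, Finset.mem_univ, if_true]
    rw [e]
    refine coord_ext fun n hn => ?_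
    rw [coord_sum]
    have hcast : ∀ k : Fin r, (((z k).toNat : ℕ) : ℝ) = (z k : ℝ) := by
      intro k
      have := Int.toNat_of_nonneg (hnn k k.isLt)
      exact_mod_cast congrArg (Int.cast (R := ℝ)) this
    simp only [coord_nsmul, hcast, coord_simpleRoot]
    rw [Fin.sum_univ_eq_sum_range
      (fun k => (z k : ℝ) * ((if n = k then (1 : ℝ) else 0) - (if n = k + 1 then 1 else 0)))]
    simp only [mul_sub, mul_ite, mul_one, mul_zero, Finset.sum_sub_distrib]
    rw [Finset.sum_ite_eq]
    -- No simple root has index `r`; the missing term is harmless since `z r = 0`.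
    have hlast : (if n ∈ Finset.range r then (z n : ℝ) else 0) = z n := by
      split_ifs with h
      · rfl
      · rw [Finset.mem_range] at h
        rw [show n = r by omega, hr, Int.cast_zero]
    rw [hlast]
    cases n with
    | zero => simp [← hz 0 (Nat.zero_le r)]
    | succ n =>
      simp only [Nat.succ_inj]
      rw [Finset.sum_ite_eq, if_pos (Finset.mem_range.mpr (by omega)), ← hz _ hn,
        ← hz n (by omega), Finset.sum_range_succ]
      ring

/-! ### The alternation set as a bound on the loss. -/

/-- The coordinates of `highestRoot r + rho r`, up to a common shift. -/
def level (r n : ℕ) : ℤ := r - n + (if n = 0 then 1 else 0) - (if n = r then 1 else 0)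

/-- The decrease of the sum of the first `m + 1` coordinates of `highestRoot r + rho r` under
the action of `σ`. -/
noncomputable def loss (r : ℕ) (σ : WeylGroup r) (m : ℕ) : ℤ :=
  ∑ n ∈ Finset.range (m + 1), (level r n - level r (act r σ n))

theorem sum_range_act {r m : ℕ} {σ : WeylGroup r} {M : Type*} [AddCommMonoid M]
    (h : ¬ Moves r σ m) (f : ℕ → M) :
    ∑ n ∈ Finset.range (m + 1), f (act r σ n) = ∑ n ∈ Finset.range (m + 1), f n := by
  conv_rhs => rw [← image_range_of_not_moves h]
  rw [Finset.sum_image (act_injective σ).injOn]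

theorem loss_eq_zero {r m : ℕ} {σ : WeylGroup r} (h : ¬ Moves r σ m) : loss r σ m = 0 := by
  rw [loss, Finset.sum_sub_distrib, sum_range_act h, sub_self]

theorem coord_highestRoot_add_rho {r n : ℕ} (hn : n ≤ r) :
    coord r (highestRoot r + rho r) n = level r n - (r : ℝ) / 2 := by
  rw [coord_add, highestRoot_eq_rootSum, coord_rootSum (by omega) (by omega) le_rfl, coord_rho hn,
    level]
  push_cast
  ring

theorem mem_alternationSet_iff {r i j : ℕ} (hi : 1 ≤ i) (hij : i ≤ j) (hj : j ≤ r)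
    {σ : WeylGroup r} :
    σ ∈ alternationSet r (highestRoot r) (-rootSum r i j) ↔
      ∀ m, m < r → loss r σ m ≤ 1 + if i ≤ m + 1 ∧ m + 1 ≤ j then 1 else 0 := by
  have hb : ∀ m k : ℕ, ∑ n ∈ Finset.range (m + 1), (if n = k then (1 : ℤ) else 0) =
      if k ≤ m then 1 else 0 := by
    intro m k
    rw [Finset.sum_ite_eq']
    simp
  have hb' : ∀ m : ℕ, ∑ n ∈ Finset.range (m + 1), (if n + 1 = i then (1 : ℤ) else 0) =
      if i ≤ m + 1 then 1 else 0 := by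
    intro m
    rw [← show (if i - 1 ≤ m then (1 : ℤ) else 0) = if i ≤ m + 1 then 1 else 0 by
      congr 1; simp only [eq_iff_iff]; omega, ← hb]
    refine Finset.sum_congr rfl fun n _ => ?_
    congr 1; simp only [eq_iff_iff]; omega
  -- The two bracketed differences are the partial sums of the highest root and of `rootSum r i j`;
  -- both vanish at `m = r`.
  rw [alternationSet, Set.mem_ofPred_eq, kostantPartition_pos_iff (z := fun m => -loss r σ m +
    (((if 0 ≤ m then 1 else 0) - if r ≤ m then 1 else 0) +
    ((if i ≤ m + 1 then 1 else 0) - if j ≤ m then 1 else 0)))]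
  · refine forall₂_congr fun m hm => ?_
    rw [if_pos (Nat.zero_le m), if_neg (show ¬ r ≤ m by omega)]
    split_ifs <;> omega
  · intro m hm
    rw [loss, ← hb', ← hb m 0, ← hb m r, ← hb m j, ← Finset.sum_sub_distrib, ← Finset.sum_sub_distrib,
      ← Finset.sum_add_distrib, ← Finset.sum_neg_distrib, ← Finset.sum_add_distrib,
      Int.cast_sum]
    refine Finset.sum_congr rfl fun n hn => ?_
    have hnr : n ≤ r := by have := Finset.mem_range.mp hn; omega
    rw [coord_sub, coord_sub, coord_weyl, coord_highestRoot_add_rho (act_le σ hnr), coord_neg,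
      coord_rootSum hi (by omega) hj, coord_rho hnr]
    have : ((level r n : ℤ) : ℝ) = r - n + (if n = 0 then 1 else 0) - (if n = r then 1 else 0) := by
      rw [level]; push_cast; rfl
    push_cast
    rw [this]
    ring
  · have : ¬ Moves r σ r := fun h => lt_irrefl _ h.lt
    simp only [loss_eq_zero this, Nat.zero_le, le_refl, if_true, if_pos hj,
      if_pos (show i ≤ r + 1 by omega)]
    norm_num

/-! ### Connectedness and independence in terms of preserved prefixes. -/

theorem dynkinDiagram_adj_iff {r : ℕ} {k l : Fin r} :
    (dynkinDiagram r).Adj k l ↔ (k : ℕ) + 1 = l ∨ (l : ℕ) + 1 = k := by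
  have h : (dynkinDiagram r).Adj k l ↔
      k ≠ l ∧ inner ℝ (simpleRoot r k) (simpleRoot r l) ≠ 0 := Iff.rfl
  rw [h, inner_simpleRoot_left, simpleRoot_apply, simpleRoot_apply, Ne, Fin.ext_iff]
  simp only [Fin.val_castSucc, Fin.val_succ]
  split_ifs <;> first | omega | (norm_num; try omega)

/-- The diagram is a path, so its connected induced subgraphs are the nonempty intervals. -/
theorem hasConnectedInfluence_iff {r : ℕ} {σ : WeylGroup r} :
    HasConnectedInfluence r σ ↔ (∃ m, Moves r σ m) ∧
      ∀ a b c, Moves r σ a → Moves r σ b → a < c → c < b → Moves r σ c := by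
  constructor
  · intro h
    refine ⟨?_, fun a b c ha hb hac hcb => ?_⟩
    · obtain ⟨⟨k, hk⟩⟩ := h.nonempty
      exact ⟨k, mem_influence_iff.mp hk⟩
    · by_contra hc
      -- Edges change the index by one, so a walk cannot jump over the missing node `c`.
      have hwalk : ∀ u v : influence r σ, ((dynkinDiagram r).induce (influence r σ)).Walk u v →
          (u : Fin r).val < c → (v : Fin r).val < c := by
        intro u v p
        induction p with
        | nil => exact id
        | cons hadj _ ih =>
          intro hu
          apply ih
          rename_i x y _ _
          have hadj' := dynkinDiagram_adj_iff.mp (SimpleGraph.induce_adj.mp hadj)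
          have hy : (y : Fin r).val ≠ c := by
            rintro rfl
            exact hc (mem_influence_iff.mp y.2)
          omega
      obtain ⟨p⟩ := h.preconnected ⟨⟨a, ha.lt⟩, mem_influence_iff.mpr ha⟩
        ⟨⟨b, hb.lt⟩, mem_influence_iff.mpr hb⟩
      have := hwalk _ _ p hac
      simp only at this
      omega
  · rintro ⟨⟨m, hm⟩, hint⟩
    have hreach : ∀ d : ℕ, ∀ x y : influence r σ, (y : Fin r).val = (x : Fin r).val + d →
        ((dynkinDiagram r).induce (influence r σ)).Reachable x y := by
      intro d
      induction d with
      | zero =>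
        intro x y h
        rw [show x = y from Subtype.ext (Fin.ext (by omega))]
      | succ d ih =>
        intro x y h
        have hz : Moves r σ ((x : Fin r).val + d) := by
          rcases Nat.eq_zero_or_pos d with rfl | hd
          · exact mem_influence_iff.mp x.2
          · exact hint _ _ _ (mem_influence_iff.mp x.2) (mem_influence_iff.mp y.2)
              (by omega) (by omega)
        refine (ih x ⟨⟨_, hz.lt⟩, mem_influence_iff.mpr hz⟩ rfl).trans
          (SimpleGraph.Adj.reachable ?_)
        rw [SimpleGraph.induce_adj, dynkinDiagram_adj_iff]
        left
        simp only
        omega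
    have : Nonempty (influence r σ) := ⟨⟨⟨m, hm.lt⟩, mem_influence_iff.mpr hm⟩⟩
    refine ⟨fun x y => ?_⟩
    rcases le_total (x : Fin r).val (y : Fin r).val with h | h
    · exact hreach _ x y (Nat.add_sub_cancel' h).symm
    · exact (hreach _ y x (Nat.add_sub_cancel' h).symm).symm

theorem independent_iff {r : ℕ} {σ τ : WeylGroup r} :
    Independent r σ τ ↔ ∀ m n, Moves r σ m → Moves r τ n → m + 1 < n ∨ n + 1 < m := by
  rw [Independent, Set.eq_empty_iff_forall_notMem]
  constructor
  · intro h m n hm hn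
    by_contra hc
    refine h ⟨m, hm.lt⟩ ⟨mem_influence_iff.mpr hm, ?_⟩
    rcases eq_or_ne m n with rfl | hne
    · exact Or.inl (mem_influence_iff.mpr hn)
    · refine Or.inr ⟨⟨n, hn.lt⟩, mem_influence_iff.mpr hn, dynkinDiagram_adj_iff.mpr ?_⟩
      simp only
      omega
  · rintro h k ⟨hk, hk' | ⟨l, hl, hkl⟩⟩
    · have := h _ _ (mem_influence_iff.mp hk) (mem_influence_iff.mp hk')
      omega
    · have := h _ _ (mem_influence_iff.mp hk) (mem_influence_iff.mp hl)
      have := dynkinDiagram_adj_iff.mp hkl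
      omega

theorem Independent.symm {r : ℕ} {σ τ : WeylGroup r} (h : Independent r σ τ) :
    Independent r τ σ := by
  rw [independent_iff] at *
  intro m n hm hn
  exact (h n m hn hm).symm

theorem Independent.not_moves {r m : ℕ} {σ τ : WeylGroup r} (h : Independent r σ τ)
    (hm : Moves r σ m) : ¬ Moves r τ m := fun hn => by
  have := independent_iff.mp h m m hm hn
  omega

theorem act_eq_self {r n : ℕ} {σ : WeylGroup r} (h : ¬ Moves r σ n)
    (h' : ∀ k, k + 1 = n → ¬ Moves r σ k) : act r σ n = n := by
  have h1 := act_le_of_not_moves h le_rfl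
  cases n with
  | zero => omega
  | succ k =>
    have : k < act r σ (k + 1) := lt_act_of_not_moves (h' k rfl) (Nat.lt_succ_self k)
    omega

theorem eq_one_of_not_moves {r : ℕ} {σ : WeylGroup r} (h : ∀ m, ¬ Moves r σ m) : σ = 1 :=
  act_ext fun n => by rw [act_eq_self (h n) fun k _ => h k, act_one]

/-- A point `n` can move only if `n` or `n - 1` lies in the influence, and independent elements
cannot both have such a node. -/
theorem Independent.act_eq_self_or {r : ℕ} {σ τ : WeylGroup r} (h : Independent r σ τ) (n : ℕ) :
    act r σ n = n ∨ act r τ n = n := by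
  rw [independent_iff] at h
  by_contra! hc
  have h1 : ∃ a, (a = n ∨ a + 1 = n) ∧ Moves r σ a := by
    by_contra! hn
    exact hc.1 (act_eq_self (hn n (Or.inl rfl)) fun k hk => hn k (Or.inr hk))
  have h2 : ∃ a, (a = n ∨ a + 1 = n) ∧ Moves r τ a := by
    by_contra! hn
    exact hc.2 (act_eq_self (hn n (Or.inl rfl)) fun k hk => hn k (Or.inr hk))
  obtain ⟨a, ha, hma⟩ := h1
  obtain ⟨b, hb, hmb⟩ := h2
  have := h a b hma hmb
  omega

theorem Independent.mul_comm {r : ℕ} {σ τ : WeylGroup r} (h : Independent r σ τ) :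
    σ * τ = τ * σ := by
  refine act_ext fun n => ?_
  rw [act_mul, act_mul]
  rcases h.act_eq_self_or n with h1 | h1
  · rw [h1]
    rcases h.act_eq_self_or (act r τ n) with h2 | h2
    · exact h2.symm
    · rw [act_injective τ h2, h1]
  · rw [h1]
    rcases h.act_eq_self_or (act r σ n) with h2 | h2
    · rw [act_injective σ h2, h1]
    · exact h2

theorem loss_mul_of_not_moves {r m : ℕ} {σ τ : WeylGroup r} (h : ¬ Moves r σ m) :
    loss r (σ * τ) m = loss r τ m := by
  simp only [loss, Finset.sum_sub_distrib, act_mul]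
  rw [sum_range_act h fun n => level r (act r τ n)]

theorem Independent.loss_mul {r : ℕ} {σ τ : WeylGroup r} (h : Independent r σ τ) (m : ℕ) :
    loss r (σ * τ) m = loss r σ m + loss r τ m := by
  by_cases hm : Moves r σ m
  · rw [h.mul_comm, loss_mul_of_not_moves (h.not_moves hm), loss_eq_zero (h.not_moves hm),
      add_zero]
  · rw [loss_mul_of_not_moves hm, loss_eq_zero hm, zero_add]

/-! ### Factorisation into connected elements and uniqueness of the basic set. -/

/-- The Weyl group elements whose loss is bounded by `c`. -/
def boundedLoss (r : ℕ) (c : ℕ → ℤ) : Set (WeylGroup r) := {σ | ∀ m, m < r → loss r σ m ≤ c m}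

theorem one_mem_boundedLoss {r : ℕ} {c : ℕ → ℤ} (hc : ∀ m, 0 ≤ c m) :
    (1 : WeylGroup r) ∈ boundedLoss r c := fun m _ => by
  rw [loss_eq_zero (not_moves_one r m)]; exact hc m

/-- At each `m` at least one of the two losses is zero; as `0 ≤ c m`, bounding their sum amounts to
bounding both. -/
theorem Independent.mul_mem_boundedLoss_iff {r : ℕ} {c : ℕ → ℤ} (hc : ∀ m, 0 ≤ c m)
    {σ τ : WeylGroup r} (h : Independent r σ τ) :
    σ * τ ∈ boundedLoss r c ↔ σ ∈ boundedLoss r c ∧ τ ∈ boundedLoss r c := by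
  have key : ∀ m, loss r σ m = 0 ∨ loss r τ m = 0 := fun m => by
    by_cases hm : Moves r σ m
    · exact Or.inr (loss_eq_zero (h.not_moves hm))
    · exact Or.inl (loss_eq_zero hm)
  constructor
  · intro hst
    constructor <;> intro m hm <;> have := hst m hm <;> rw [h.loss_mul] at this <;>
      have := hc m <;> have := key m <;> omega
  · rintro ⟨hs, ht⟩ m hm
    have := hs m hm
    have := ht m hm
    have := key m
    rw [h.loss_mul]
    omega

theorem moves_mul {r m : ℕ} {σ τ : WeylGroup r} (h : Moves r (σ * τ) m) :
    Moves r σ m ∨ Moves r τ m := by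
  by_cases hs : Moves r σ m
  · exact Or.inl hs
  · exact Or.inr ((moves_mul_iff_right hs).mp h)

theorem exists_moves_of_moves_prod {r m : ℕ} {l : List (WeylGroup r)} (h : Moves r l.prod m) :
    ∃ t ∈ l, Moves r t m := by
  induction l with
  | nil => exact absurd h (not_moves_one r m)
  | cons t l ih =>
    rw [List.prod_cons] at h
    rcases moves_mul h with h | h
    · exact ⟨t, List.mem_cons_self, h⟩
    · obtain ⟨t', ht', hm⟩ := ih h
      exact ⟨t', List.mem_cons_of_mem _ ht', hm⟩

theorem independent_prod {r : ℕ} {t : WeylGroup r} {l : List (WeylGroup r)}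
    (h : ∀ t' ∈ l, Independent r t t') : Independent r t l.prod := by
  rw [independent_iff]
  intro m n hm hn
  obtain ⟨t', ht', hn'⟩ := exists_moves_of_moves_prod hn
  exact independent_iff.mp (h t' ht') m n hm hn'

theorem prod_mem_boundedLoss {r : ℕ} {c : ℕ → ℤ} (hc : ∀ m, 0 ≤ c m) {l : List (WeylGroup r)}
    (hl : l.Pairwise (Independent r)) (hmem : ∀ t ∈ l, t ∈ boundedLoss r c) :
    l.prod ∈ boundedLoss r c := by
  induction l with
  | nil => exact one_mem_boundedLoss hc
  | cons t l ih =>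
    rw [List.pairwise_cons] at hl
    rw [List.prod_cons, (independent_prod hl.1).mul_mem_boundedLoss_iff hc]
    exact ⟨hmem t List.mem_cons_self, ih hl.2 fun t' ht' => hmem t' (List.mem_cons_of_mem _ ht')⟩

theorem pairwise_of_isProductOf {r : ℕ} {T : Set (WeylGroup r)} {l : List (WeylGroup r)}
    (hT : PairwiseIndependent r T) (hl : l.Nodup) (hlT : {b | b ∈ l} = T) :
    l.Pairwise (Independent r) :=
  hl.pairwise_of_forall_ne fun _ ha _ hb hab => hT (hlT ▸ ha) (hlT ▸ hb) hab

/-- The permutation preserves `{0, …, c}` and its complement; the factors are its restrictions to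
the two, extended by the identity. -/
theorem exists_cut {r c : ℕ} {σ : WeylGroup r} (h : ¬ Moves r σ c) :
    ∃ σ₁ σ₂ : WeylGroup r, σ = σ₁ * σ₂ ∧ (∀ m, Moves r σ₁ m ↔ m < c ∧ Moves r σ m) ∧
      ∀ m, Moves r σ₂ m ↔ c < m ∧ Moves r σ m := by
  have hle : ∀ n, n ≤ c → act r σ n ≤ c := fun n => act_le_of_not_moves h
  have hlt : ∀ n, c < n → c < act r σ n := fun n => lt_act_of_not_moves h
  obtain ⟨σ₁, h₁⟩ := exists_act_eq (r := r) (f := fun n => if n ≤ c then act r σ n else n)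
    (by
      intro a b hab
      simp only at hab
      have := hle a
      have := hle b
      split_ifs at hab
      · exact act_injective σ hab
      · omega
      · omega
      · exact hab)
    (by
      intro n hn
      simp only [act_of_gt σ hn, ite_self])
  obtain ⟨σ₂, h₂⟩ := exists_act_eq (r := r) (f := fun n => if n ≤ c then n else act r σ n)
    (by
      intro a b hab
      simp only at hab
      have := hlt a
      have := hlt b
      split_ifs at hab
      · exact hab
      · omega
      · omega
      · exact act_injective σ hab)
    (by
      intro n hn
      simp only [act_of_gt σ hn, ite_self])
  have hσ : σ = σ₁ * σ₂ := by
    refine act_ext fun n => ?_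
    rw [act_mul, h₂, h₁]
    have := hle n
    split_ifs <;> first | rfl | omega
  have hm₁ : ∀ m, c ≤ m → ¬ Moves r σ₁ m := by
    rintro m hm ⟨a, ha, hma⟩
    rw [h₁] at hma
    have := hle a
    split_ifs at hma <;> omega
  have hm₂ : ∀ m, m ≤ c → ¬ Moves r σ₂ m := by
    rintro m hm ⟨a, ha, hma⟩
    rw [h₂] at hma
    split_ifs at hma <;> omega
  refine ⟨σ₁, σ₂, hσ, fun m => ?_, fun m => ?_⟩
  · rcases lt_or_ge m c with hm | hm
    · rw [hσ, moves_mul_iff_left (hm₂ m hm.le)]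
      exact ⟨fun h => ⟨hm, h⟩, fun h => h.2⟩
    · exact iff_of_false (hm₁ m hm) fun h => by omega
  · rcases lt_or_ge c m with hm | hm
    · rw [hσ, moves_mul_iff_right (hm₁ m hm.le)]
      exact ⟨fun h => ⟨hm, h⟩, fun h => h.2⟩
    · exact iff_of_false (hm₂ m hm) fun h => by omega

open Classical in
-- Induction on the size of the influence, cutting at a gap: each side loses a node lying on the
-- other.
theorem exists_list_connected {r : ℕ} {c : ℕ → ℤ} (hc : ∀ m, 0 ≤ c m) {σ : WeylGroup r}
    (hσ : σ ∈ boundedLoss r c) :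
    ∃ l : List (WeylGroup r), l.Pairwise (Independent r) ∧ l.prod = σ ∧
      ∀ t ∈ l, t ∈ boundedLoss r c ∧ HasConnectedInfluence r t ∧
        ∀ m, Moves r t m → Moves r σ m := by
  induction hn : ((Finset.range r).filter (Moves r σ)).card using Nat.strong_induction_on
    generalizing σ with
  | _ n ih =>
    by_cases h1 : ∀ m, ¬ Moves r σ m
    · exact ⟨[], List.Pairwise.nil, (eq_one_of_not_moves h1).symm, by simp⟩
    · push Not at h1
      by_cases hconn : HasConnectedInfluence r σ
      · exact ⟨[σ], List.pairwise_singleton _ _, List.prod_singleton, by simp [hσ, hconn]⟩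
      · rw [hasConnectedInfluence_iff] at hconn
        push Not at hconn
        obtain ⟨a, b, d, ha, hb, had, hdb, hd⟩ := hconn h1
        obtain ⟨σ₁, σ₂, hprod, hm₁, hm₂⟩ := exists_cut hd
        have hind : Independent r σ₁ σ₂ := by
          rw [independent_iff]
          intro m k hm hk
          have := (hm₁ m).mp hm
          have := (hm₂ k).mp hk
          omega
        have hmem : σ₁ * σ₂ ∈ boundedLoss r c := hprod ▸ hσ
        rw [hind.mul_mem_boundedLoss_iff hc] at hmem
        have hlt : ∀ (τ : WeylGroup r) (x : ℕ), (∀ m, Moves r τ m → Moves r σ m) →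
            Moves r σ x → ¬ Moves r τ x → ((Finset.range r).filter (Moves r τ)).card < n := by
          intro τ x hτ hx hx'
          rw [← hn]
          apply Finset.card_lt_card
          refine ⟨Finset.monotone_filter_right _ fun m _ => hτ m, fun hsub => hx' ?_⟩
          exact (Finset.mem_filter.mp
            (hsub (Finset.mem_filter.mpr ⟨Finset.mem_range.mpr hx.lt, hx⟩))).2
        obtain ⟨l₁, hl₁, hp₁, ht₁⟩ := ih _ (hlt σ₁ b (fun m h => ((hm₁ m).mp h).2) hb
          fun h => by have := (hm₁ b).mp h; omega) hmem.1 rfl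
        obtain ⟨l₂, hl₂, hp₂, ht₂⟩ := ih _ (hlt σ₂ a (fun m h => ((hm₂ m).mp h).2) ha
          fun h => by have := (hm₂ a).mp h; omega) hmem.2 rfl
        refine ⟨l₁ ++ l₂, ?_, by rw [List.prod_append, hp₁, hp₂, hprod], fun t ht => ?_⟩
        · rw [List.pairwise_append]
          refine ⟨hl₁, hl₂, fun t ht t' ht' => ?_⟩
          rw [independent_iff]
          intro m k hm hk
          exact independent_iff.mp hind m k ((ht₁ t ht).2.2 m hm) ((ht₂ t' ht').2.2 k hk)
        · rcases List.mem_append.mp ht with ht | ht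
          · exact ⟨(ht₁ t ht).1, (ht₁ t ht).2.1, fun m hm => ((hm₁ m).mp ((ht₁ t ht).2.2 m hm)).2⟩
          · exact ⟨(ht₂ t ht).1, (ht₂ t ht).2.1, fun m hm => ((hm₂ m).mp ((ht₂ t ht).2.2 m hm)).2⟩

/-- If the union were an interval, moving up one node at a time from one influence could never enter
the other, since independence forbids adjacent nodes. -/
theorem not_hasConnectedInfluence_mul {r : ℕ} {σ τ : WeylGroup r} (h : Independent r σ τ)
    (hσ : ∃ m, Moves r σ m) (hτ : ∃ m, Moves r τ m) : ¬ HasConnectedInfluence r (σ * τ) := by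
  intro hconn
  obtain ⟨a, ha⟩ := hσ
  obtain ⟨b, hb⟩ := hτ
  have key : ∀ (σ τ : WeylGroup r) (a b : ℕ), Independent r σ τ →
      HasConnectedInfluence r (σ * τ) → Moves r σ a → Moves r τ b → ¬ a < b := by
    intro σ τ a b h hconn ha hb hab
    have hall : ∀ d, a + d ≤ b → Moves r σ (a + d) := by
      intro d
      induction d with
      | zero => exact fun _ => ha
      | succ d ih =>
        intro hd
        have hσd := ih (by omega)
        have hprod : Moves r (σ * τ) (a + (d + 1)) := by
          rcases eq_or_lt_of_le hd with he | hlt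
          · rw [he, h.mul_comm, moves_mul_iff_left (h.symm.not_moves hb)]
            exact hb
          · exact (hasConnectedInfluence_iff.mp hconn).2 a b _
              ((moves_mul_iff_left (h.not_moves ha)).mpr ha)
              ((moves_mul_iff_right (h.symm.not_moves hb)).mpr hb) (by omega) (by omega)
        rcases moves_mul hprod with hm | hm
        · exact hm
        · have := independent_iff.mp h _ _ hσd hm
          omega
    have := hall (b - a) (by omega)
    rw [show a + (b - a) = b by omega] at this
    exact h.not_moves this hb
  have h1 := key σ τ a b h hconn ha hb
  have h2 := key τ σ b a h.symm (h.mul_comm ▸ hconn) hb ha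
  have := independent_iff.mp h a b ha hb
  omega

/-- A connected element cannot be a product of two nontrivial independent factors, so it must itself
belong to `S`; conversely the connected elements suffice by `exists_list_connected`. -/
theorem isBAS_iff {r : ℕ} {c : ℕ → ℤ} (hc : ∀ m, 0 ≤ c m) {lam μ : Ambient r}
    (hA : alternationSet r lam μ = boundedLoss r c) {S : Set (WeylGroup r)} :
    IsBAS r lam μ S ↔ S = {σ | σ ∈ boundedLoss r c ∧ HasConnectedInfluence r σ} := by
  constructor
  · intro h
    ext σ
    refine ⟨fun hσ => ⟨hA ▸ h.subset hσ, h.connected σ hσ⟩, ?_⟩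
    rintro ⟨hσ, hconn⟩
    obtain ⟨T, hTS, hT, l, hl, hlT, rfl⟩ := h.generates σ (hA ▸ hσ)
    have hpw := pairwise_of_isProductOf hT hl hlT
    have hlS : ∀ t ∈ l, t ∈ S := fun t ht => hTS (hlT ▸ ht)
    cases l with
    | nil =>
      obtain ⟨m, hm⟩ := (hasConnectedInfluence_iff.mp hconn).1
      exact absurd hm (not_moves_one r m)
    | cons t l =>
      rw [List.pairwise_cons] at hpw
      have ht := (hasConnectedInfluence_iff.mp (h.connected t (hlS t List.mem_cons_self))).1
      by_cases hp : ∃ m, Moves r l.prod m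
      · exact absurd hconn (by
          rw [List.prod_cons]
          exact not_hasConnectedInfluence_mul (independent_prod hpw.1) ht hp)
      · push Not at hp
        rw [List.prod_cons, eq_one_of_not_moves hp, mul_one]
        exact hlS t List.mem_cons_self
  · rintro rfl
    refine ⟨fun σ hσ => hA ▸ hσ.1, fun h1 => ?_, fun σ hσ => hσ.2, fun σ hσ => ?_⟩
    · obtain ⟨m, hm⟩ := (hasConnectedInfluence_iff.mp h1.2).1
      exact not_moves_one r m hm
    · obtain ⟨l, hl, hp, ht⟩ := exists_list_connected hc (hA ▸ hσ)
      refine ⟨{b | b ∈ l}, fun t h => ⟨(ht t h).1, (ht t h).2.1⟩, fun a ha b hb hab => ?_,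
        l, ?_, rfl, hp⟩
      · have : Std.Symm (Independent r) := ⟨fun _ _ h => h.symm⟩
        exact hl.forall ha hb hab
      -- A repeated factor would be independent of itself, hence have empty influence.
      · refine hl.imp_of_mem fun ha _ hind => ?_
        rintro rfl
        obtain ⟨m, hm⟩ := (hasConnectedInfluence_iff.mp (ht _ ha).2.1).1
        exact hind.not_moves hm hm

theorem mem_alternationSet_iff_of_isBAS {r : ℕ} {c : ℕ → ℤ} (hc : ∀ m, 0 ≤ c m)
    {lam μ : Ambient r} (hA : alternationSet r lam μ = boundedLoss r c) {S : Set (WeylGroup r)}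
    (hS : IsBAS r lam μ S) (σ : WeylGroup r) :
    σ ∈ alternationSet r lam μ ↔ ∃ T ⊆ S, PairwiseIndependent r T ∧ IsProductOf r T σ := by
  refine ⟨hS.generates σ, ?_⟩
  rintro ⟨T, hTS, hT, l, hl, hlT, rfl⟩
  rw [hA]
  exact prod_mem_boundedLoss hc (pairwise_of_isProductOf hT hl hlT) fun t ht =>
    hA ▸ hS.subset (hTS (hlT ▸ ht))

/-! ### Permutations with connected influence and displacement at most two. -/

/-- The total displacement of the first `m + 1` coordinates. -/
noncomputable def shift (r : ℕ) (σ : WeylGroup r) (m : ℕ) : ℤ :=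
  ∑ n ∈ Finset.range (m + 1), ((act r σ n : ℤ) - n)

theorem shift_of_eq_succ {r m k : ℕ} (σ : WeylGroup r) (h : k = m + 1) :
    shift r σ k = shift r σ m + (act r σ k - k) := by
  rw [h, shift, Finset.sum_range_succ]
  rfl

theorem shift_eq_zero {r m : ℕ} {σ : WeylGroup r} (h : ¬ Moves r σ m) : shift r σ m = 0 := by
  rw [shift, Finset.sum_sub_distrib, sum_range_act h fun n => (n : ℤ), sub_self]

/-- The prefix and its image have equal size. Indices entering are at least `m + 1`, those leaving
at most `m`, so each exchange gains at least one. -/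
theorem shift_pos {r m : ℕ} {σ : WeylGroup r} (h : Moves r σ m) : 1 ≤ shift r σ m := by
  set R := Finset.range (m + 1) with hR
  set B := R.image (act r σ) with hB
  have hcard : (B \ R).card = (R \ B).card :=
    Finset.card_sdiff_comm (Finset.card_image_of_injective _ (act_injective σ))
  have hsum : shift r σ m = ∑ n ∈ B, (n : ℤ) - ∑ n ∈ R, (n : ℤ) := by
    rw [shift, Finset.sum_sub_distrib, hB, Finset.sum_image (act_injective σ).injOn]
  have h1 : (B \ R).card • ((m : ℤ) + 1) ≤ ∑ n ∈ B \ R, (n : ℤ) := by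
    apply Finset.card_nsmul_le_sum
    intro n hn
    have := (Finset.mem_sdiff.mp hn).2
    rw [hR, Finset.mem_range] at this
    omega
  have h2 : ∑ n ∈ R \ B, (n : ℤ) ≤ (R \ B).card • (m : ℤ) := by
    apply Finset.sum_le_card_nsmul
    intro n hn
    have := (Finset.mem_sdiff.mp hn).1
    rw [hR, Finset.mem_range] at this
    omega
  have h3 : 0 < (B \ R).card := by
    obtain ⟨a, ha, hm⟩ := h
    refine Finset.card_pos.mpr ⟨act r σ a, Finset.mem_sdiff.mpr ⟨?_, ?_⟩⟩
    · exact Finset.mem_image_of_mem _ (Finset.mem_range.mpr (by omega))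
    · rw [hR, Finset.mem_range]
      omega
  rw [hsum, ← Finset.sum_sdiff_sub_sum_sdiff]
  rw [← hcard] at h2
  simp only [smul_add, nsmul_eq_mul, mul_one] at h1 h2
  omega

/-- The excess is `1 - [0 in the image of the prefix] + [r in the image of the prefix]`, coming from
the highest root at the two end coordinates. -/
theorem shift_le_loss {r m : ℕ} (σ : WeylGroup r) (hm : m < r) : shift r σ m ≤ loss r σ m := by
  have h1 : (∑ n ∈ Finset.range (m + 1), if n = 0 then (1 : ℤ) else 0) = 1 := by simp
  have h2 : (∑ n ∈ Finset.range (m + 1), if n = r then (1 : ℤ) else 0) = 0 := by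
    rw [Finset.sum_ite_eq', if_neg (by rw [Finset.mem_range]; omega)]
  have h3 : (∑ n ∈ Finset.range (m + 1), if act r σ n = 0 then (1 : ℤ) else 0) ≤ 1 := by
    rw [Finset.sum_boole]
    norm_cast
    rw [Finset.card_le_one]
    intro a ha b hb
    rw [Finset.mem_filter] at ha hb
    exact act_injective σ (ha.2.trans hb.2.symm)
  have h4 : (0 : ℤ) ≤ ∑ n ∈ Finset.range (m + 1), if act r σ n = r then (1 : ℤ) else 0 :=
    Finset.sum_nonneg fun n _ => by split_ifs <;> norm_num
  have h5 : loss r σ m = shift r σ m +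
      ((∑ n ∈ Finset.range (m + 1), if n = 0 then (1 : ℤ) else 0) -
        (∑ n ∈ Finset.range (m + 1), if n = r then (1 : ℤ) else 0) -
        (∑ n ∈ Finset.range (m + 1), if act r σ n = 0 then (1 : ℤ) else 0) +
        ∑ n ∈ Finset.range (m + 1), if act r σ n = r then (1 : ℤ) else 0) := by
    rw [loss, shift, ← Finset.sum_sub_distrib, ← Finset.sum_sub_distrib,
      ← Finset.sum_add_distrib, ← Finset.sum_add_distrib]
    refine Finset.sum_congr rfl fun n _ => ?_
    rw [level, level]
    ring
  omega

/-! ### The permutations of the five kinds of words. -/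

theorem act_s_succ {r a : ℕ} (h : a + 1 ≤ r) (n : ℕ) :
    act r (s r (a + 1)) n = if n = a then a + 1 else if n = a + 1 then a else n := by
  rw [act_s (by omega) h]
  split_ifs <;> omega

theorem act_s_mul_s {r a : ℕ} (h : a + 2 ≤ r) (n : ℕ) :
    act r (s r (a + 2) * s r (a + 1)) n =
      if n = a then a + 1 else if n = a + 1 then a + 2 else if n = a + 2 then a else n := by
  rw [act_mul, act_s_succ (show a + 1 + 1 ≤ r by omega), act_s_succ (by omega)]
  split_ifs <;> omega

theorem act_s_mul_s' {r a : ℕ} (h : a + 2 ≤ r) (n : ℕ) :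
    act r (s r (a + 1) * s r (a + 2)) n =
      if n = a then a + 2 else if n = a + 1 then a else if n = a + 2 then a + 1 else n := by
  rw [act_mul, act_s_succ (show a + 1 + 1 ≤ r by omega), act_s_succ (by omega)]
  split_ifs <;> omega

theorem act_s_mul_s_mul_s {r a : ℕ} (h : a + 2 ≤ r) (n : ℕ) :
    act r (s r (a + 1) * s r (a + 2) * s r (a + 1)) n =
      if n = a then a + 2 else if n = a + 2 then a else n := by
  rw [act_mul, act_s_mul_s' h, act_s_succ (by omega)]
  split_ifs <;> omega

theorem act_s_mul_s_mul_s' {r a : ℕ} (h : a + 3 ≤ r) (n : ℕ) :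
    act r (s r (a + 3) * s r (a + 1) * s r (a + 2)) n =
      if n = a then a + 2 else if n = a + 1 then a else if n = a + 2 then a + 3 else
        if n = a + 3 then a + 1 else n := by
  rw [mul_assoc, act_mul, act_s_mul_s' (by omega), act_s_succ (show a + 2 + 1 ≤ r by omega)]
  split_ifs <;> omega

/-- With `a` the first node, `act r σ n - n` is the increment of `shift`. The disjuncts are the
shift patterns (1), (1,2), (2,1), (2,2), (2,1,2); all are stated on one window of four indices so
that `eq_of_act_window` applies uniformly. -/
theorem exists_act_of_connected {r : ℕ} {c : ℕ → ℤ} (hc : ∀ m, c m ≤ 2) {σ : WeylGroup r}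
    (hσ : σ ∈ boundedLoss r c) (hconn : HasConnectedInfluence r σ) :
    ∃ a x y z w, act r σ a = x ∧ act r σ (a + 1) = y ∧ act r σ (a + 2) = z ∧
      act r σ (a + 3) = w ∧ (∀ n, n < a ∨ a + 4 ≤ n → act r σ n = n) ∧
      (a + 1 ≤ r ∧ x = a + 1 ∧ y = a ∧ z = a + 2 ∧ w = a + 3 ∨
      a + 2 ≤ r ∧ x = a + 1 ∧ y = a + 2 ∧ z = a ∧ w = a + 3 ∨
      a + 2 ≤ r ∧ x = a + 2 ∧ y = a ∧ z = a + 1 ∧ w = a + 3 ∨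
      a + 2 ≤ r ∧ x = a + 2 ∧ y = a + 1 ∧ z = a ∧ w = a + 3 ∨
      a + 3 ≤ r ∧ x = a + 2 ∧ y = a ∧ z = a + 3 ∧ w = a + 1) := by
  classical
  rw [hasConnectedInfluence_iff] at hconn
  obtain ⟨hex, hint⟩ := hconn
  obtain ⟨a, ha, hmin⟩ : ∃ a, Moves r σ a ∧ ∀ n, n < a → ¬ Moves r σ n :=
    ⟨Nat.find hex, Nat.find_spec hex, fun n => Nat.find_min hex⟩
  refine ⟨a, _, _, _, _, rfl, rfl, rfl, rfl, ?_⟩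
  have hbeyond : ∀ m n, a < m → m < n → ¬ Moves r σ m → ¬ Moves r σ n :=
    fun m n ham hmn hm hn => hm (hint a n m ha hn ham hmn)
  have hle2 : ∀ m, shift r σ m ≤ 2 := by
    intro m
    rcases lt_or_ge m r with hm | hm
    · exact ((shift_le_loss σ hm).trans (hσ m hm)).trans (hc m)
    · rw [shift_eq_zero fun h => by have := h.lt; omega]; norm_num
  have hbelow : ∀ n, n < a → act r σ n = n :=
    fun n hn => act_eq_self (hmin n hn) fun k hk => hmin k (by omega)
  have hge : ∀ n, a ≤ n → a ≤ act r σ n := by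
    intro n hn
    by_contra hlt
    have h1 := hbelow (act r σ n) (by omega)
    have := act_injective σ h1
    omega
  have h0 : (act r σ a : ℤ) = a + shift r σ a := by
    cases a with
    | zero => simp [shift]
    | succ b =>
      rw [shift_of_eq_succ σ rfl, shift_eq_zero (hmin b (by omega))]
      ring
  have h1 := shift_of_eq_succ σ (show a + 1 = a + 1 from rfl)
  have h2 := shift_of_eq_succ σ (show a + 2 = a + 1 + 1 from rfl)
  have h3 := shift_of_eq_succ σ (show a + 3 = a + 2 + 1 from rfl)
  push_cast at h1 h2 h3
  have g0 := shift_pos ha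
  have l0 := hle2 a
  have l1 := hle2 (a + 1)
  have l2 := hle2 (a + 2)
  have l3 := hle2 (a + 3)
  have ne : ∀ x y, x < y → act r σ (a + x) ≠ act r σ (a + y) := by
    intro x y hxy h
    have := act_injective σ h
    omega
  have n01 : act r σ a ≠ _ := ne 0 1 (by omega)
  have n02 : act r σ a ≠ _ := ne 0 2 (by omega)
  have n03 : act r σ a ≠ _ := ne 0 3 (by omega)
  have n12 := ne 1 2 (by omega)
  have n13 := ne 1 3 (by omega)
  have n23 := ne 2 3 (by omega)
  have e1 := hge (a + 1) (by omega)
  -- Each of the sixteen patterns of four values in `{1, 2}` repeats a value of the permutation on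
  -- the window.
  have m3 : ¬ Moves r σ (a + 3) := by
    intro m3
    have g3 := shift_pos m3
    have g2 := shift_pos (hint a (a + 3) (a + 2) ha m3 (by omega) (by omega))
    have g1 := shift_pos (hint a (a + 3) (a + 1) ha m3 (by omega) (by omega))
    have c0 : shift r σ a = 1 ∨ shift r σ a = 2 := by omega
    have c1 : shift r σ (a + 1) = 1 ∨ shift r σ (a + 1) = 2 := by omega
    have c2 : shift r σ (a + 2) = 1 ∨ shift r σ (a + 2) = 2 := by omega
    have c3 : shift r σ (a + 3) = 1 ∨ shift r σ (a + 3) = 2 := by omega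
    clear g0 g1 g2 g3 l0 l1 l2 l3 e1
    rcases c0 with c0 | c0 <;> rcases c1 with c1 | c1 <;> rcases c2 with c2 | c2 <;>
      rcases c3 with c3 | c3 <;> rw [c0] at h0 h1 <;> rw [c1] at h1 h2 <;>
      rw [c2] at h2 h3 <;> rw [c3] at h3 <;> omega
  have z3 := shift_eq_zero m3
  refine ⟨fun n hn => ?_, ?_⟩
  · rcases hn with hn | hn
    · exact hbelow n hn
    · refine act_eq_self (hbeyond (a + 3) n (by omega) (by omega) m3) fun k hk => ?_
      rcases eq_or_ne k (a + 3) with rfl | hne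
      · exact m3
      · exact hbeyond (a + 3) k (by omega) (by omega) m3
  · have hr0 := ha.lt
    by_cases m1 : Moves r σ (a + 1)
    · have g1 := shift_pos m1
      have hr1 := m1.lt
      have c0 : shift r σ a = 1 ∨ shift r σ a = 2 := by omega
      have c1 : shift r σ (a + 1) = 1 ∨ shift r σ (a + 1) = 2 := by omega
      by_cases m2 : Moves r σ (a + 2)
      · have g2 := shift_pos m2
        have hr2 := m2.lt
        have c2 : shift r σ (a + 2) = 1 ∨ shift r σ (a + 2) = 2 := by omega
        have v : shift r σ a = 2 ∧ shift r σ (a + 1) = 1 ∧ shift r σ (a + 2) = 2 := by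
          clear l0 l1 l2 l3 g0 g1 g2
          rcases c0 with c0 | c0 <;> rcases c1 with c1 | c1 <;> rcases c2 with c2 | c2 <;>
            rw [c0] at h0 h1 <;> rw [c1] at h1 h2 <;> rw [c2] at h2 h3 <;> rw [z3] at h3 <;>
            omega
        clear n01 n02 n03 n12 n13 n23
        exact Or.inr (Or.inr (Or.inr (Or.inr (by omega))))
      · have z2 := shift_eq_zero m2
        have hne : ¬ (shift r σ a = 1 ∧ shift r σ (a + 1) = 1) := by
          clear n02 n03 n12 n13 n23
          omega
        clear n01 n02 n03 n12 n13 n23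
        rcases c0 with c0 | c0 <;> rcases c1 with c1 | c1
        · exact absurd ⟨c0, c1⟩ hne
        · exact Or.inr (Or.inl (by omega))
        · exact Or.inr (Or.inr (Or.inl (by omega)))
        · exact Or.inr (Or.inr (Or.inr (Or.inl (by omega))))
    · have z1 := shift_eq_zero m1
      have z2 := shift_eq_zero (hbeyond (a + 1) (a + 2) (by omega) (by omega) m1)
      clear n01 n02 n03 n12 n13 n23
      exact Or.inl (by omega)

theorem eq_of_act_window {r a : ℕ} {σ τ : WeylGroup r}
    (hσ : ∀ n, n < a ∨ a + 4 ≤ n → act r σ n = n) (hτ : ∀ n, n < a ∨ a + 4 ≤ n → act r τ n = n)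
    (h0 : act r σ a = act r τ a) (h1 : act r σ (a + 1) = act r τ (a + 1))
    (h2 : act r σ (a + 2) = act r τ (a + 2)) (h3 : act r σ (a + 3) = act r τ (a + 3)) : σ = τ := by
  refine act_ext fun n => ?_
  by_cases hn : n < a ∨ a + 4 ≤ n
  · rw [hσ n hn, hτ n hn]
  · obtain rfl | rfl | rfl | rfl : n = a ∨ n = a + 1 ∨ n = a + 2 ∨ n = a + 3 := by omega
    all_goals assumption

theorem exists_eq_of_connected {r : ℕ} {c : ℕ → ℤ} (hc : ∀ m, c m ≤ 2) {σ : WeylGroup r}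
    (hσ : σ ∈ boundedLoss r c) (hconn : HasConnectedInfluence r σ) :
    ∃ a, (a + 1 ≤ r ∧ σ = s r (a + 1)) ∨
      (a + 2 ≤ r ∧ σ = s r (a + 2) * s r (a + 1)) ∨
      (a + 2 ≤ r ∧ σ = s r (a + 1) * s r (a + 2)) ∨
      (a + 2 ≤ r ∧ σ = s r (a + 1) * s r (a + 2) * s r (a + 1)) ∨
      (a + 3 ≤ r ∧ σ = s r (a + 3) * s r (a + 1) * s r (a + 2)) := by
  obtain ⟨a, x, y, z, w, hx, hy, hz, hw, hout, h⟩ := exists_act_of_connected hc hσ hconn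
  refine ⟨a, ?_⟩
  obtain ⟨hr, rfl, rfl, rfl, rfl⟩ | ⟨hr, rfl, rfl, rfl, rfl⟩ | ⟨hr, rfl, rfl, rfl, rfl⟩ |
    ⟨hr, rfl, rfl, rfl, rfl⟩ | ⟨hr, rfl, rfl, rfl, rfl⟩ := h
  · refine Or.inl ⟨hr, eq_of_act_window hout (fun n hn => ?_) ?_ ?_ ?_ ?_⟩ <;>
      rw [act_s_succ hr] <;> split_ifs <;> omega
  · refine Or.inr (Or.inl ⟨hr, eq_of_act_window hout (fun n hn => ?_) ?_ ?_ ?_ ?_⟩) <;>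
      rw [act_s_mul_s hr] <;> split_ifs <;> omega
  · refine Or.inr (Or.inr (Or.inl ⟨hr, eq_of_act_window hout (fun n hn => ?_) ?_ ?_ ?_ ?_⟩)) <;>
      rw [act_s_mul_s' hr] <;> split_ifs <;> omega
  · refine Or.inr (Or.inr (Or.inr (Or.inl
      ⟨hr, eq_of_act_window hout (fun n hn => ?_) ?_ ?_ ?_ ?_⟩))) <;>
      rw [act_s_mul_s_mul_s hr] <;> split_ifs <;> omega
  · refine Or.inr (Or.inr (Or.inr (Or.inr
      ⟨hr, eq_of_act_window hout (fun n hn => ?_) ?_ ?_ ?_ ?_⟩))) <;>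
      rw [act_s_mul_s_mul_s' hr] <;> split_ifs <;> omega

/-! ### Which of the five kinds of words satisfy the bound. -/

theorem loss_succ {r : ℕ} (σ : WeylGroup r) (m : ℕ) :
    loss r σ (m + 1) = loss r σ m + (level r (m + 1) - level r (act r σ (m + 1))) :=
  Finset.sum_range_succ _ _

theorem loss_first {r a : ℕ} {σ : WeylGroup r} (h : ∀ n, n < a → ¬ Moves r σ n) :
    loss r σ a = level r a - level r (act r σ a) := by
  cases a with
  | zero => simp [loss]
  | succ b => rw [loss_succ, loss_eq_zero (h b (Nat.lt_succ_self b)), zero_add]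

theorem mem_iff_of_moves_iff {r a w : ℕ} {c : ℕ → ℤ} (hc : ∀ m, 0 ≤ c m) {σ : WeylGroup r}
    (h : ∀ m, Moves r σ m ↔ a ≤ m ∧ m < a + w) (hw : 0 < w) :
    σ ∈ boundedLoss r c ∧ HasConnectedInfluence r σ ↔
      ∀ d, d < w → loss r σ (a + d) ≤ c (a + d) := by
  constructor
  · rintro ⟨hσ, -⟩ d hd
    exact hσ _ ((h (a + d)).mpr ⟨by omega, by omega⟩).lt
  · intro hl
    refine ⟨fun m _ => ?_, hasConnectedInfluence_iff.mpr ⟨⟨a, (h a).mpr (by omega)⟩, ?_⟩⟩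
    · by_cases hm : Moves r σ m
      · have := (h m).mp hm
        have := hl (m - a) (by omega)
        rwa [Nat.add_sub_cancel' (by omega)] at this
      · rw [loss_eq_zero hm]; exact hc m
    · intro x y z hx hy hxz hzy
      rw [h] at *
      omega

/-- The bound on the loss of the elements of the alternation set of the negative root
`-rootSum r i j`. -/
def lossBound (i j m : ℕ) : ℤ := 1 + if i ≤ m + 1 ∧ m + 1 ≤ j then 1 else 0

theorem lossBound_nonneg (i j m : ℕ) : 0 ≤ lossBound i j m := by
  unfold lossBound; split_ifs <;> norm_num

theorem lossBound_le_two (i j m : ℕ) : lossBound i j m ≤ 2 := by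
  unfold lossBound; split_ifs <;> norm_num

theorem alternationSet_eq {r i j : ℕ} (hi : 1 ≤ i) (hij : i ≤ j) (hj : j ≤ r) :
    alternationSet r (highestRoot r) (-rootSum r i j) = boundedLoss r (lossBound i j) :=
  Set.ext fun _ => mem_alternationSet_iff hi hij hj

theorem forall_lt_two {P : ℕ → Prop} : (∀ d, d < 2 → P d) ↔ P 0 ∧ P 1 := by
  refine ⟨fun h => ⟨h 0 (by omega), h 1 (by omega)⟩, fun h d hd => ?_⟩
  obtain rfl | rfl : d = 0 ∨ d = 1 := by omega
  exacts [h.1, h.2]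

theorem forall_lt_three {P : ℕ → Prop} : (∀ d, d < 3 → P d) ↔ P 0 ∧ P 1 ∧ P 2 := by
  refine ⟨fun h => ⟨h 0 (by omega), h 1 (by omega), h 2 (by omega)⟩, fun h d hd => ?_⟩
  obtain rfl | rfl | rfl : d = 0 ∨ d = 1 ∨ d = 2 := by omega
  exacts [h.1, h.2.1, h.2.2]

/-- The loss at `a` is `1 + [a = 0] + [a + 1 = r]`. For `r = 1` it equals 3 and exceeds every bound,
whence `2 ≤ r`. -/
theorem s_basic_iff {r i j a : ℕ} (hi : 1 ≤ i) (hij : i ≤ j) (hj : j ≤ r) (ha : a + 1 ≤ r) :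
    s r (a + 1) ∈ boundedLoss r (lossBound i j) ∧ HasConnectedInfluence r (s r (a + 1)) ↔
      2 ≤ r ∧ (a = 0 → i = 1) ∧ (a + 1 = r → j = r) := by
  have hm : ∀ m, Moves r (s r (a + 1)) m ↔ a ≤ m ∧ m < a + 1 := by
    intro m
    constructor
    · rintro ⟨b, hb, h⟩
      rw [act_s_succ ha] at h
      split_ifs at h <;> omega
    · rintro ⟨h1, h2⟩
      exact ⟨a, h1, by rw [act_s_succ ha, if_pos rfl]; omega⟩
  rw [mem_iff_of_moves_iff (lossBound_nonneg i j) hm one_pos]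
  simp only [Nat.lt_one_iff, forall_eq, Nat.add_zero]
  rw [loss_first fun n hn h => by have := (hm n).mp h; omega, act_s_succ ha, if_pos rfl]
  unfold level lossBound
  push_cast
  split_ifs <;> omega

/-- Shift pattern (1,2): the 2 at `a + 1` gives the condition on `i` and `j`. If the influence
reaches an end of the diagram, this 2 becomes a loss of at least 3, so the end nodes are excluded.
-/
theorem s_mul_s_basic_iff {r i j a : ℕ} (ha : a + 2 ≤ r) :
    s r (a + 2) * s r (a + 1) ∈ boundedLoss r (lossBound i j) ∧
      HasConnectedInfluence r (s r (a + 2) * s r (a + 1)) ↔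
      1 ≤ a ∧ a + 3 ≤ r ∧ i ≤ a + 2 ∧ a + 2 ≤ j := by
  have hm : ∀ m, Moves r (s r (a + 2) * s r (a + 1)) m ↔ a ≤ m ∧ m < a + 2 := by
    intro m
    constructor
    · rintro ⟨b, hb, h⟩
      rw [act_s_mul_s ha] at h
      split_ifs at h <;> omega
    · rintro ⟨h1, h2⟩
      exact ⟨m, le_rfl, by rw [act_s_mul_s ha]; split_ifs <;> omega⟩
  rw [mem_iff_of_moves_iff (lossBound_nonneg i j) hm two_pos, forall_lt_two, Nat.add_zero a,
    loss_succ, loss_first fun n hn h => by have := (hm n).mp h; omega, act_s_mul_s ha,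
    act_s_mul_s ha]
  simp only [if_true, if_neg (show a + 1 ≠ a by omega)]
  unfold level lossBound
  push_cast
  split_ifs <;> omega

theorem s_mul_s_basic_iff' {r i j a : ℕ} (ha : a + 2 ≤ r) :
    s r (a + 1) * s r (a + 2) ∈ boundedLoss r (lossBound i j) ∧
      HasConnectedInfluence r (s r (a + 1) * s r (a + 2)) ↔
      1 ≤ a ∧ a + 3 ≤ r ∧ i ≤ a + 1 ∧ a + 1 ≤ j := by
  have hm : ∀ m, Moves r (s r (a + 1) * s r (a + 2)) m ↔ a ≤ m ∧ m < a + 2 := by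
    intro m
    constructor
    · rintro ⟨b, hb, h⟩
      rw [act_s_mul_s' ha] at h
      split_ifs at h <;> omega
    · rintro ⟨h1, h2⟩
      exact ⟨a, h1, by rw [act_s_mul_s' ha, if_pos rfl]; omega⟩
  rw [mem_iff_of_moves_iff (lossBound_nonneg i j) hm two_pos, forall_lt_two, Nat.add_zero a,
    loss_succ, loss_first fun n hn h => by have := (hm n).mp h; omega, act_s_mul_s' ha,
    act_s_mul_s' ha]
  simp only [if_true, if_neg (show a + 1 ≠ a by omega)]
  unfold level lossBound
  push_cast
  split_ifs <;> omega

theorem s_mul_s_mul_s_basic_iff {r i j a : ℕ} (ha : a + 2 ≤ r) :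
    s r (a + 1) * s r (a + 2) * s r (a + 1) ∈ boundedLoss r (lossBound i j) ∧
      HasConnectedInfluence r (s r (a + 1) * s r (a + 2) * s r (a + 1)) ↔
      1 ≤ a ∧ a + 3 ≤ r ∧ i ≤ a + 1 ∧ a + 2 ≤ j := by
  have hm : ∀ m, Moves r (s r (a + 1) * s r (a + 2) * s r (a + 1)) m ↔ a ≤ m ∧ m < a + 2 := by
    intro m
    constructor
    · rintro ⟨b, hb, h⟩
      rw [act_s_mul_s_mul_s ha] at h
      split_ifs at h <;> omega
    · rintro ⟨h1, h2⟩
      exact ⟨a, h1, by rw [act_s_mul_s_mul_s ha, if_pos rfl]; omega⟩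
  rw [mem_iff_of_moves_iff (lossBound_nonneg i j) hm two_pos, forall_lt_two, Nat.add_zero a,
    loss_succ, loss_first fun n hn h => by have := (hm n).mp h; omega, act_s_mul_s_mul_s ha,
    act_s_mul_s_mul_s ha]
  simp only [if_true, if_neg (show a + 1 ≠ a by omega), if_neg (show a + 1 ≠ a + 2 by omega)]
  unfold level lossBound
  push_cast
  split_ifs <;> omega

/-- Shift pattern (2,1,2): both `a + 1` and `a + 3` must lie in `[i, j]`, and the end nodes are
again excluded. -/
theorem s_mul_s_mul_s_basic_iff' {r i j a : ℕ} (ha : a + 3 ≤ r) :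
    s r (a + 3) * s r (a + 1) * s r (a + 2) ∈ boundedLoss r (lossBound i j) ∧
      HasConnectedInfluence r (s r (a + 3) * s r (a + 1) * s r (a + 2)) ↔
      1 ≤ a ∧ a + 4 ≤ r ∧ i ≤ a + 1 ∧ a + 3 ≤ j := by
  have hm : ∀ m, Moves r (s r (a + 3) * s r (a + 1) * s r (a + 2)) m ↔ a ≤ m ∧ m < a + 3 := by
    intro m
    constructor
    · rintro ⟨b, hb, h⟩
      rw [act_s_mul_s_mul_s' ha] at h
      split_ifs at h <;> omega
    · rintro ⟨h1, h2⟩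
      rcases lt_or_ge m (a + 2) with h3 | h3
      · exact ⟨a, h1, by rw [act_s_mul_s_mul_s' ha, if_pos rfl]; omega⟩
      · exact ⟨a + 2, h3, by rw [act_s_mul_s_mul_s' ha]; split_ifs <;> omega⟩
  rw [mem_iff_of_moves_iff (lossBound_nonneg i j) hm three_pos, forall_lt_three, Nat.add_zero a,
    loss_succ _ (a + 1), loss_succ _ a, loss_first fun n hn h => by have := (hm n).mp h; omega,
    act_s_mul_s_mul_s' ha, act_s_mul_s_mul_s' ha, act_s_mul_s_mul_s' ha]
  simp only [if_true, if_neg (show a + 1 ≠ a by omega), if_neg (show a + 1 + 1 ≠ a by omega),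
    if_neg (show a + 1 + 1 ≠ a + 1 by omega)]
  unfold level lossBound
  push_cast
  split_ifs <;> omega

/-! ### Assembly and translation to one-based ranges. -/

theorem basic_eq {r i j : ℕ} (hi : 1 ≤ i) (hij : i ≤ j) (hj : j ≤ r) :
    {σ | σ ∈ boundedLoss r (lossBound i j) ∧ HasConnectedInfluence r σ} =
      {σ | ∃ a, (a + 1 ≤ r ∧ 2 ≤ r ∧ (a = 0 → i = 1) ∧ (a + 1 = r → j = r)) ∧ σ = s r (a + 1)} ∪
      {σ | ∃ a, (1 ≤ a ∧ a + 3 ≤ r ∧ i ≤ a + 2 ∧ a + 2 ≤ j) ∧ σ = s r (a + 2) * s r (a + 1)} ∪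
      {σ | ∃ a, (1 ≤ a ∧ a + 3 ≤ r ∧ i ≤ a + 1 ∧ a + 1 ≤ j) ∧ σ = s r (a + 1) * s r (a + 2)} ∪
      {σ | ∃ a, (1 ≤ a ∧ a + 3 ≤ r ∧ i ≤ a + 1 ∧ a + 2 ≤ j) ∧
        σ = s r (a + 1) * s r (a + 2) * s r (a + 1)} ∪
      {σ | ∃ a, (1 ≤ a ∧ a + 4 ≤ r ∧ i ≤ a + 1 ∧ a + 3 ≤ j) ∧
        σ = s r (a + 3) * s r (a + 1) * s r (a + 2)} := by
  ext σ
  constructor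
  · intro h
    obtain ⟨a, h'⟩ := exists_eq_of_connected (lossBound_le_two i j) h.1 h.2
    obtain ⟨ha, rfl⟩ | ⟨ha, rfl⟩ | ⟨ha, rfl⟩ | ⟨ha, rfl⟩ | ⟨ha, rfl⟩ := h'
    · exact Or.inl (Or.inl (Or.inl (Or.inl ⟨a, ⟨ha, (s_basic_iff hi hij hj ha).mp h⟩, rfl⟩)))
    · exact Or.inl (Or.inl (Or.inl (Or.inr ⟨a, (s_mul_s_basic_iff ha).mp h, rfl⟩)))
    · exact Or.inl (Or.inl (Or.inr ⟨a, (s_mul_s_basic_iff' ha).mp h, rfl⟩))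
    · exact Or.inl (Or.inr ⟨a, (s_mul_s_mul_s_basic_iff ha).mp h, rfl⟩)
    · exact Or.inr ⟨a, (s_mul_s_mul_s_basic_iff' ha).mp h, rfl⟩
  · rintro ((((⟨a, ⟨ha, h⟩, rfl⟩ | ⟨a, h, rfl⟩) | ⟨a, h, rfl⟩) | ⟨a, h, rfl⟩) | ⟨a, h, rfl⟩)
    · exact (s_basic_iff hi hij hj ha).mpr h
    · exact (s_mul_s_basic_iff (by omega)).mpr h
    · exact (s_mul_s_basic_iff' (by omega)).mpr h
    · exact (s_mul_s_mul_s_basic_iff (by omega)).mpr h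
    · exact (s_mul_s_mul_s_basic_iff' (by omega)).mpr h

theorem setOf_exists_eq_of_index_shift {α : Type*} {P Q : ℕ → Prop} {f : ℕ → α}
    (h0 : ¬ Q 0) (h : ∀ a, P a ↔ Q (a + 1)) :
    {x | ∃ a, P a ∧ x = f (a + 1)} = {x | ∃ k, Q k ∧ x = f k} := by
  ext x
  constructor
  · rintro ⟨a, ha, rfl⟩
    exact ⟨a + 1, (h a).mp ha, rfl⟩
  · rintro ⟨k, hk, rfl⟩
    cases k with
    | zero => exact absurd hk h0
    | succ a => exact ⟨a, (h a).mpr hk, rfl⟩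

/-- Reduces each case of the theorem to linear arithmetic on ranges. The positive lower ends exclude
the index 0, which no zero-based `a` reaches after the shift. -/
theorem isBAS_iff_eq_families {r i j : ℕ} (hi : 1 ≤ i) (hij : i ≤ j) (hj : j ≤ r)
    {a₁ a₂ b₁ b₂ c₁ c₂ d₁ d₂ e₁ e₂ : ℕ} (h1 : 1 ≤ a₁ ∧ 2 ≤ b₁ ∧ 2 ≤ c₁ ∧ 2 ≤ d₁ ∧ 2 ≤ e₁)
    (hA : ∀ k, (k + 1 ≤ r ∧ 2 ≤ r ∧ (k = 0 → i = 1) ∧ (k + 1 = r → j = r)) ↔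
      a₁ ≤ k + 1 ∧ k + 1 ≤ a₂)
    (hB : ∀ k, (1 ≤ k ∧ k + 3 ≤ r ∧ i ≤ k + 2 ∧ k + 2 ≤ j) ↔ b₁ ≤ k + 1 ∧ k + 1 ≤ b₂)
    (hC : ∀ k, (1 ≤ k ∧ k + 3 ≤ r ∧ i ≤ k + 1 ∧ k + 1 ≤ j) ↔ c₁ ≤ k + 1 ∧ k + 1 ≤ c₂)
    (hD : ∀ k, (1 ≤ k ∧ k + 3 ≤ r ∧ i ≤ k + 1 ∧ k + 2 ≤ j) ↔ d₁ ≤ k + 1 ∧ k + 1 ≤ d₂)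
    (hE : ∀ k, (1 ≤ k ∧ k + 4 ≤ r ∧ i ≤ k + 1 ∧ k + 3 ≤ j) ↔ e₁ ≤ k + 1 ∧ k + 1 ≤ e₂)
    (S : Set (WeylGroup r)) :
    IsBAS r (highestRoot r) (-rootSum r i j) S ↔
      S = familyA r a₁ a₂ ∪ familyB r b₁ b₂ ∪ familyC r c₁ c₂ ∪ familyD r d₁ d₂ ∪
        familyE r e₁ e₂ := by
  rw [isBAS_iff (lossBound_nonneg i j) (alternationSet_eq hi hij hj), basic_eq hi hij hj,
    setOf_exists_eq_of_index_shift (Q := fun k => a₁ ≤ k ∧ k ≤ a₂) (f := s r) (by omega) hA,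
    setOf_exists_eq_of_index_shift (Q := fun k => b₁ ≤ k ∧ k ≤ b₂)
      (f := fun k => s r (k + 1) * s r k) (by omega) hB,
    setOf_exists_eq_of_index_shift (Q := fun k => c₁ ≤ k ∧ k ≤ c₂)
      (f := fun k => s r k * s r (k + 1)) (by omega) hC,
    setOf_exists_eq_of_index_shift (Q := fun k => d₁ ≤ k ∧ k ≤ d₂)
      (f := fun k => s r k * s r (k + 1) * s r k) (by omega) hD,
    setOf_exists_eq_of_index_shift (Q := fun k => e₁ ≤ k ∧ k ≤ e₂)
      (f := fun k => s r (k + 2) * s r k * s r (k + 1)) (by omega) hE]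
  simp only [familyA, familyB, familyC, familyD, familyE, and_assoc]

end TypeA

/-- The five conjuncts: the alternation set is nonempty and consists exactly of the products of
pairwise independent sets of basic allowable subwords; the set of basic allowable subwords for
`i = 1 ≤ j < r`; for `1 < i ≤ j = r`; for `1 < i ≤ j < r`; and for the remaining negative root
`-α_(1,r)`. The natural-number subtractions only occur as upper ends of ranges whose lower end is
at least `2` (or as `r - 1` with `r ≥ 2`, `i - 1` with `i ≥ 2`), so truncation has no effect. -/
theorem mainTheorem6 (r : ℕ) (hr : 1 ≤ r) :
    (∀ i j : ℕ, 1 ≤ i → i ≤ j → j ≤ r →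
      (TypeA.alternationSet r (TypeA.highestRoot r) (-TypeA.rootSum r i j)).Nonempty ∧
      ∀ S : Set (TypeA.WeylGroup r),
        TypeA.IsBAS r (TypeA.highestRoot r) (-TypeA.rootSum r i j) S →
        ∀ σ : TypeA.WeylGroup r,
          σ ∈ TypeA.alternationSet r (TypeA.highestRoot r) (-TypeA.rootSum r i j) ↔
            ∃ T ⊆ S, TypeA.PairwiseIndependent r T ∧ TypeA.IsProductOf r T σ) ∧
    (∀ j : ℕ, 1 ≤ j → j < r → ∀ S : Set (TypeA.WeylGroup r),
      TypeA.IsBAS r (TypeA.highestRoot r) (-TypeA.rootSum r 1 j) S ↔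
        S = TypeA.familyA r 1 (r - 1) ∪
            TypeA.familyB r 2 (j - 1) ∪
            TypeA.familyC r 2 (min j (r - 2)) ∪
            TypeA.familyD r 2 (j - 1) ∪
            TypeA.familyE r 2 (j - 2)) ∧
    (∀ i : ℕ, 1 < i → i ≤ r → ∀ S : Set (TypeA.WeylGroup r),
      TypeA.IsBAS r (TypeA.highestRoot r) (-TypeA.rootSum r i r) S ↔
        S = TypeA.familyA r 2 r ∪
            TypeA.familyB r (max (i - 1) 2) (r - 2) ∪
            TypeA.familyC r i (r - 2) ∪
            TypeA.familyD r i (r - 2) ∪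
            TypeA.familyE r i (r - 3)) ∧
    (∀ i j : ℕ, 1 < i → i ≤ j → j < r → ∀ S : Set (TypeA.WeylGroup r),
      TypeA.IsBAS r (TypeA.highestRoot r) (-TypeA.rootSum r i j) S ↔
        S = TypeA.familyA r 2 (r - 1) ∪
            TypeA.familyB r (max (i - 1) 2) (j - 1) ∪
            TypeA.familyC r i (min j (r - 2)) ∪
            TypeA.familyD r i (j - 1) ∪
            TypeA.familyE r i (j - 2)) ∧
    (∀ S : Set (TypeA.WeylGroup r),
      TypeA.IsBAS r (TypeA.highestRoot r) (-TypeA.rootSum r 1 r) S ↔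
        S = if r = 1 then ∅ else
            TypeA.familyA r 1 r ∪
            TypeA.familyB r 2 (r - 2) ∪
            TypeA.familyC r 2 (r - 2) ∪
            TypeA.familyD r 2 (r - 2) ∪
            TypeA.familyE r 2 (r - 3)) := by
  refine ⟨fun i j hi hij hj => ?_, fun j hj hjr S => ?_, fun i hi hir S => ?_,
    fun i j hi hij hjr S => ?_, fun S => ?_⟩
  · have hA := TypeA.alternationSet_eq hi hij hj
    refine ⟨⟨1, ?_⟩, fun S hS σ => ?_⟩
    · rw [hA]
      exact TypeA.one_mem_boundedLoss (TypeA.lossBound_nonneg i j)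
    · exact TypeA.mem_alternationSet_iff_of_isBAS (TypeA.lossBound_nonneg i j) hA hS σ
  · apply TypeA.isBAS_iff_eq_families <;> intros <;> omega
  · apply TypeA.isBAS_iff_eq_families <;> intros <;> omega
  · apply TypeA.isBAS_iff_eq_families <;> intros <;> omega
  · split_ifs with h
    · subst h
      rw [TypeA.isBAS_iff (TypeA.lossBound_nonneg 1 1)
        (TypeA.alternationSet_eq le_rfl le_rfl le_rfl), TypeA.basic_eq le_rfl le_rfl le_rfl]
      refine Eq.congr_right (Set.eq_empty_iff_forall_notMem.mpr fun σ => ?_)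
      -- For `r = 1` each of the five index conditions is contradictory.
      rintro ((((⟨a, h, -⟩ | ⟨a, h, -⟩) | ⟨a, h, -⟩) | ⟨a, h, -⟩) | ⟨a, h, -⟩) <;> omega
    · apply TypeA.isBAS_iff_eq_families <;> intros <;> omega
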